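/- **Proposition (On the origin of continuum mechanics with distortion).** All indices run over $\{1,2,3\}$, repeated indices are summed, $\partial_i=\partial/\partial x^i$, and $\Omega\subset\mathbb R^3$ is open. *Functional derivatives.* For a functional $C$ of fields on an open set $U\subset\mathbb R^3$, $C_q=\delta C/\delta q$ at a field $q$ denotes the smooth field on $U$ with $\frac{d}{dt}\big|_{0}C(q+\eta_t)=\int_U C_q\cdot\dot\eta_0$ for every smooth curve $\eta_t$ of smooth variations supported in a fixed compact subset of $U$, $\eta_0=0$. If it exists, $C$ is called smoothly differentiable at $q$. In 1, 3 and 4 below, one of the two functionals is assumed to have a functional derivative of compact support in $\Omega$, at the Eulerian fields in question. *Lagrangian fields.* Let $B\subset\mathbb R^3$ be open, let $\rho_0,s_0$ be smooth real functions on $B$, let $\mathbf x:B\to\Omega$ be a smooth bijection with $\det(\partial\mathbf x/\partial\mathbf X)>0$ and inverse $\mathbf X(\mathbf x)$, and let $\mathbf M:B\to\mathbb R^3$ be smooth. The canonical bracket is $$\{C,D\}^{(L)}=\int_B \Big(\frac{\delta C}{\delta x^i}\frac{\delta D}{\delta M_i}-\frac{\delta D}{\delta x^i}\frac{\delta C}{\delta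 M_i}\Big)d\mathbf X .$$ *Eulerian fields on $\Omega$.* With $J=\det(\partial\mathbf X/\partial\mathbf x)$, $$\rho(\mathbf x)=\rho_0(\mathbf X(\mathbf x))J,\quad \mathbf m(\mathbf x)=\mathbf M(\mathbf X(\mathbf x))J,\quad s(\mathbf x)=s_0(\mathbf X(\mathbf x))J,\quad F^i_{\ I}(\mathbf x)=\frac{\partial x^i}{\partial X^I}\Big|_{\mathbf X(\mathbf x)},\quad A=F^{-1}.$$ *Brackets.* Let $$\{C,D\}^{(FM)}=\int_\Omega\rho(\partial_iC_\rho D_{m_i}-\partial_iD_\rho C_{m_i})+\int_\Omega m_i(\partial_jC_{m_i}D_{m_j}-\partial_jD_{m_i}C_{m_j})+\int_\Omega s(\partial_iC_sD_{m_i}-\partial_iD_sC_{m_i}),$$ $$\{C,D\}^{(F)}=\{C,D\}^{(FM)}+\int_\Omega F^j_{\ I}\big(C_{F^i_{\ I}}\partial_jD_{m_i}-D_{F^i_{\ I}}\partial_jC_{m_i}\big)-\int_\Omega\partial_kF^i_{\ I}\big(C_{F^i_{\ I}}D_{m_k}-D_{F^i_{\ I}}C_{m_k}\big),$$ $$\{C,D\}^{(A)}=\{C,D\}^{(FM)}-\int_\Omega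 A^L_{\ i}\big(C_{A^L_{\ l}}\partial_lD_{m_i}-D_{A^L_{\ l}}\partial_lC_{m_i}\big)-\int_\Omega\partial_iA^L_{\ l}\big(C_{A^L_{\ l}}D_{m_i}-D_{A^L_{\ l}}C_{m_i}\big).$$ Then the following hold. 1. If $C,D$ are functionals of $(\rho,\mathbf m,s,F)$, smoothly differentiable at the Eulerian fields of $(\mathbf x,\mathbf M)$, then, as functionals of $(\mathbf x,\mathbf M)$, they are smoothly differentiable, and $\{C,D\}^{(L)}=\{C,D\}^{(F)}$. 2. If $(\rho,\mathbf m,s,F)$ are any smooth fields on $\Omega$ with $F$ invertible at every point ($F$ need not be a deformation gradient) and $C,D$ are functionals of $(\rho,\mathbf m,s,A)$, smoothly differentiable at $(\rho,\mathbf m,s,F^{-1})$, then, as functionals of $(\rho,\mathbf m,s,F)$ through $A=F^{-1}$, they are smoothly differentiable, and $\{C,D\}^{(F)}=\{C,D\}^{(A)}$. 3. If $C,D$ are functionals of $(\rho,\mathbf m,s,A)$, smoothly differentiable at the Eulerian fields of $(\mathbf x,\mathbf M)$, then, as functionals of $(\mathbf x,\mathbf M)$, they are smoothly differentiable, and $\{C,D\}^{(L)}=\{C,D\}^{(A)}$.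 4. The bracket $\{\cdot,\cdot\}^{(A)}$ expresses the kinematics of $(\rho,\mathbf m,s,A)$: for arbitrary smooth fields on $\Omega$ ($A$ need be neither curl-free nor invertible) and functionals $C,E$ smoothly differentiable there, $$\{C,E\}^{(A)}=\int_\Omega\big(C_\rho\, R_\rho+C_{m_i}R_{m_i}+C_s\, R_s+C_{A^L_{\ l}}R_{A^L_{\ l}}\big),$$ where $$R_\rho=-\partial_i(\rho E_{m_i}),\qquad R_s=-\partial_i(sE_{m_i}),\qquad R_{A^L_{\ l}}=-\partial_l(A^L_{\ i}E_{m_i})+(\partial_lA^L_{\ i}-\partial_iA^L_{\ l})E_{m_i},$$ $$R_{m_i}=-\partial_j(m_iE_{m_j})-\rho\,\partial_iE_\rho-m_j\partial_iE_{m_j}-s\,\partial_iE_s-A^L_{\ l}\partial_iE_{A^L_{\ l}}+\partial_i(A^L_{\ l}E_{A^L_{\ l}})-\partial_l(A^L_{\ i}E_{A^L_{\ l}}).$$ Moreover, let $z(t)=(\rho,\mathbf m,s,A)(t)$ be fields smooth in time and space, and let $E$ be smoothly differentiable at $z(t)$ for a given time $t$. Then $\frac{d}{dt}C(z(t))=\{C,E\}^{(A)}(z(t))$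 holds at that time for all $C(z)=\int_\Omega\varphi\cdot z$ with $\varphi$ smooth and compactly supported in $\Omega$ if and only if $\partial_t\rho=R_\rho$, $\partial_tm_i=R_{m_i}$, $\partial_ts=R_s$ and $\partial_tA^L_{\ l}=R_{A^L_{\ l}}$ hold on $\Omega$ at that time. -/

import Mathlib

open Set MeasureTheory
open scoped ContDiff

noncomputable section

namespace ContinuumMechanics

/-- Coordinate vectors, and points of (Lagrangian or Eulerian) three-dimensional space. -/
abbrev Vec : Type := Fin 3 → ℝ

/-- Three-by-three arrays of reals. -/
abbrev Mat3 : Type := Fin 3 → Fin 3 → ℝ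

/-- Values of the Lagrangian fields `(x, M)`. -/
abbrev LState : Type := Vec × Vec

/-- Values of the Eulerian fields `(ρ, m, s, T)`, where `T` is either the deformation gradient,
`T i I = F^i_I`, or the distortion, `T L l = A^L_l`. -/
abbrev EState : Type := ℝ × Vec × ℝ × Mat3

/-- The `i`-th coordinate vector. -/
def e (i : Fin 3) : Vec := Pi.single i 1

/-- The partial derivative `∂_i f` at `y`. -/
def pd (i : Fin 3) (f : Vec → ℝ) (y : Vec) : ℝ := fderiv ℝ f y (e i)

section FunctionalDerivative

variable {W : Type} [NormedAddCommGroup W] [NormedSpace ℝ W]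

/-- A smooth curve `t ↦ η t`, `-ε < t < ε`, of smooth variations of `W`-valued fields on `U`,
all of them vanishing outside one compact subset of `U`, and starting at `η 0 = 0`. -/
def IsVariation (U : Set Vec) (ε : ℝ) (η : ℝ → Vec → W) : Prop :=
  0 < ε ∧ ContDiffOn ℝ ∞ (Function.uncurry η) (Ioo (-ε) ε ×ˢ univ) ∧
    (∃ K : Set Vec, IsCompact K ∧ K ⊆ U ∧ ∀ t ∈ Ioo (-ε) ε, ∀ y, y ∉ K → η t y = 0) ∧
    η 0 = 0

/-- The functional `C` of `W`-valued fields on `U` has, at the field `z`, the functional derivative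
`g`; here `g y` is a covector, so that `g y w` is the component of `δC/δz(y)` along `w`.
The differential is taken along all smooth curves of compactly supported smooth variations: this
contains the curves `z + t • φ` with `φ` a test function (the Gateaux derivative), and it holds
whenever `C` is Fréchet differentiable with respect to test-function variations. -/
def HasFunctionalDeriv (U : Set Vec) (C : (Vec → W) → ℝ) (z : Vec → W)
    (g : Vec → W →L[ℝ] ℝ) : Prop :=
  ∀ (ε : ℝ) (η : ℝ → Vec → W), IsVariation U ε η →
    HasDerivAt (fun t => C (z + η t)) (∫ y in U, g y (deriv (fun t => η t y) 0)) 0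

/-- `C` has at `z` a functional derivative that is a smooth field on `U`. -/
def SmoothlyDifferentiableAt (U : Set Vec) (C : (Vec → W) → ℝ) (z : Vec → W) : Prop :=
  ∃ g : Vec → W →L[ℝ] ℝ, ContDiffOn ℝ ∞ g U ∧ HasFunctionalDeriv U C z g

open Classical in
/-- The functional derivative `δC/δz` on `U` (unique there, for `U` open); zero if there is no
smooth one. -/
def funcDeriv (U : Set Vec) (C : (Vec → W) → ℝ) (z : Vec → W) : Vec → W →L[ℝ] ℝ :=
  if h : SmoothlyDifferentiableAt U C z then h.choose else 0

/-- The functional derivative of `C` at `z` vanishes outside a compact subset of `U`. -/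
def CompactlySupportedDeriv (U : Set Vec) (C : (Vec → W) → ℝ) (z : Vec → W) : Prop :=
  ∃ K : Set Vec, IsCompact K ∧ K ⊆ U ∧ ∀ y ∈ U, y ∉ K → funcDeriv U C z y = 0

end FunctionalDerivative

/-! ### The Lagrangian frame -/

/-- `δC/δx^i`. -/
def dX (B : Set Vec) (C : (Vec → LState) → ℝ) (q : Vec → LState) (i : Fin 3) (X : Vec) : ℝ :=
  funcDeriv B C q X (e i, 0)

/-- `δC/δM_i`. -/
def dMom (B : Set Vec) (C : (Vec → LState) → ℝ) (q : Vec → LState) (i : Fin 3) (X : Vec) : ℝ :=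
  funcDeriv B C q X (0, e i)

/-- The canonical Poisson bracket of functionals of `(x, M)`, at `q = (x, M)`. -/
def bracketL (B : Set Vec) (C D : (Vec → LState) → ℝ) (q : Vec → LState) : ℝ :=
  ∫ X in B, ∑ i, (dX B C q i X * dMom B D q i X - dX B D q i X * dMom B C q i X)

/-- The position field `x(X)` of `q = (x, M)`. -/
def pos (q : Vec → LState) (X : Vec) : Vec := (q X).1

/-- The momentum field `M(X)` of `q = (x, M)`. -/
def mom (q : Vec → LState) (X : Vec) : Vec := (q X).2

/-- `q = (x, M)` are smooth fields on the body `B`, and `x` is an orientation-preserving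
diffeomorphism of `B` onto `Ω`. -/
structure IsConfiguration (B Ω : Set Vec) (q : Vec → LState) : Prop where
  smooth : ContDiffOn ℝ ∞ q B
  injOn : InjOn (pos q) B
  image : pos q '' B = Ω
  det_pos : ∀ X ∈ B, 0 < (fderiv ℝ (pos q) X).det

/-- The inverse `X(x)` of the position field. -/
def lab (B : Set Vec) (q : Vec → LState) : Vec → Vec := Function.invFunOn (pos q) B

/-! ### The Eulerian frame -/

open Classical in
/-- The Eulerian fields `(ρ, m, s, F)` of `q = (x, M)`, for the reference mass and entropy densities
`ρ₀`, `s₀`. They are fields on `x(B)`, extended by zero. -/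
def toEulerF (B : Set Vec) (ρ₀ s₀ : Vec → ℝ) (q : Vec → LState) : Vec → EState := fun y =>
  if y ∈ pos q '' B then
    (ρ₀ (lab B q y) * (fderiv ℝ (lab B q) y).det,
     (fderiv ℝ (lab B q) y).det • mom q (lab B q y),
     s₀ (lab B q y) * (fderiv ℝ (lab B q) y).det,
     fun i I => fderiv ℝ (pos q) (lab B q y) (e I) i)
  else 0

/-- The pointwise change of variables `(ρ, m, s, F) ↦ (ρ, m, s, A)` with `A = F⁻¹`. -/
def toDistortion (z : Vec → EState) : Vec → EState := fun y =>
  ((z y).1, (z y).2.1, (z y).2.2.1, fun L l => ((Matrix.of (z y).2.2.2)⁻¹ : Matrix _ _ ℝ) L l)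

/-- The Eulerian fields `(ρ, m, s, A)` of `q = (x, M)`. -/
def toEulerA (B : Set Vec) (ρ₀ s₀ : Vec → ℝ) (q : Vec → LState) : Vec → EState :=
  toDistortion (toEulerF B ρ₀ s₀ q)

/-- The density `ρ` of the Eulerian fields `z`. -/
def rho (z : Vec → EState) (y : Vec) : ℝ := (z y).1

/-- The component `m_i` of the momentum density. -/
def mo (z : Vec → EState) (i : Fin 3) (y : Vec) : ℝ := (z y).2.1 i

/-- The entropy density `s`. -/
def ent (z : Vec → EState) (y : Vec) : ℝ := (z y).2.2.1

/-- The component `F^a_b`, respectively `A^a_b`, of the last Eulerian field. -/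
def ten (z : Vec → EState) (a b : Fin 3) (y : Vec) : ℝ := (z y).2.2.2 a b

section Brackets

variable (Ω : Set Vec) (C D : (Vec → EState) → ℝ) (z : Vec → EState)

/-- `C_ρ`. -/
def dRho (y : Vec) : ℝ := funcDeriv Ω C z y (1, 0, 0, 0)

/-- `C_{m_i}`. -/
def dMo (i : Fin 3) (y : Vec) : ℝ := funcDeriv Ω C z y (0, e i, 0, 0)

/-- `C_s`. -/
def dEnt (y : Vec) : ℝ := funcDeriv Ω C z y (0, 0, 1, 0)

/-- The derivative of `C` with respect to the component `F^a_b`, respectively `A^a_b`. -/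
def dTen (a b : Fin 3) (y : Vec) : ℝ := funcDeriv Ω C z y (0, 0, 0, Pi.single a (e b))

/-- The Poisson bracket of fluid mechanics. -/
def bracketFM : ℝ :=
  (∫ y in Ω, ∑ i, rho z y *
    (pd i (dRho Ω C z) y * dMo Ω D z i y - pd i (dRho Ω D z) y * dMo Ω C z i y))
  + (∫ y in Ω, ∑ i, ∑ j, mo z i y *
    (pd j (dMo Ω C z i) y * dMo Ω D z j y - pd j (dMo Ω D z i) y * dMo Ω C z j y))
  + ∫ y in Ω, ∑ i, ent z y *
    (pd i (dEnt Ω C z) y * dMo Ω D z i y - pd i (dEnt Ω D z) y * dMo Ω C z i y)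

/-- The bracket of functionals of `(ρ, m, s, F)`; here `ten z i I` is `F^i_I`. -/
def bracketF : ℝ :=
  bracketFM Ω C D z
  + (∫ y in Ω, ∑ i, ∑ j, ∑ I, ten z j I y *
    (dTen Ω C z i I y * pd j (dMo Ω D z i) y - dTen Ω D z i I y * pd j (dMo Ω C z i) y))
  - ∫ y in Ω, ∑ i, ∑ I, ∑ k, pd k (ten z i I) y *
    (dTen Ω C z i I y * dMo Ω D z k y - dTen Ω D z i I y * dMo Ω C z k y)

/-- The bracket of functionals of `(ρ, m, s, A)`; here `ten z L l` is `A^L_l`. -/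
def bracketA : ℝ :=
  bracketFM Ω C D z
  - (∫ y in Ω, ∑ L, ∑ l, ∑ i, ten z L i y *
    (dTen Ω C z L l y * pd l (dMo Ω D z i) y - dTen Ω D z L l y * pd l (dMo Ω C z i) y))
  - ∫ y in Ω, ∑ L, ∑ l, ∑ i, pd i (ten z L l) y *
    (dTen Ω C z L l y * dMo Ω D z i y - dTen Ω D z L l y * dMo Ω C z i y)

end Brackets

/-- The right-hand sides of the evolution equations of `(ρ, m, s, A)` for the energy `E`. -/
def evolutionA (Ω : Set Vec) (E : (Vec → EState) → ℝ) (z : Vec → EState) (y : Vec) : EState :=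
  (- ∑ i, pd i (fun x => rho z x * dMo Ω E z i x) y,
   fun i =>
    - (∑ j, pd j (fun x => mo z i x * dMo Ω E z j x) y)
    - rho z y * pd i (dRho Ω E z) y
    - (∑ j, mo z j y * pd i (dMo Ω E z j) y)
    - ent z y * pd i (dEnt Ω E z) y
    - (∑ L, ∑ l, ten z L l y * pd i (dTen Ω E z L l) y)
    + pd i (fun x => ∑ L, ∑ l, ten z L l x * dTen Ω E z L l x) y
    - ∑ l, pd l (fun x => ∑ L, ten z L i x * dTen Ω E z L l x) y,
   - ∑ i, pd i (fun x => ent z x * dMo Ω E z i x) y,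
   fun L l =>
    - pd l (fun x => ∑ i, ten z L i x * dMo Ω E z i x) y
    + ∑ i, (pd l (ten z L i) y - pd i (ten z L l) y) * dMo Ω E z i y)

/-- A smooth test covector field with compact support in `Ω`. -/
def IsTest (Ω : Set Vec) (φ : Vec → EState →L[ℝ] ℝ) : Prop :=
  ContDiff ℝ ∞ φ ∧ HasCompactSupport φ ∧ tsupport φ ⊆ Ω

/-- The fields `z` smeared with `φ`. -/
def smeared (Ω : Set Vec) (φ : Vec → EState →L[ℝ] ℝ) (z : Vec → EState) : ℝ :=
  ∫ y in Ω, φ y (z y)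

end ContinuumMechanics

end

open ContinuumMechanics

noncomputable section

namespace ContinuumMechanics

/-! ### Smooth functions on open sets -/

/-! The Eulerian brackets are the canonical bracket seen through the map from Lagrangian to Eulerian
fields, so the essential point is the chain rule for that map. Vary `(x, M)` with compact support.
Read on `Ω`, the variation of `x` is a displacement `h t`, and the varied motion is `(id + h t) ∘
x`. Hence the Eulerian fields are moved by the diffeomorphism `id + h t`: densities are composed
with its inverse `G t` and multiplied by `det DG`, `F` is composed with `G t` and multiplied on the
left by `1 + ∇h`, and the momentum density also receives `J δM` (`toEulerF_add`). With `v` the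
velocity of `h` at time zero, the rates are `-div(ρv)`, `-div(sv)`, `-div(mv) + w` and `(∇v)F -
v·∇F` (`deriv_transport`).

Pairing these rates with `δC` and integrating by parts, which is legitimate because `v` has compact
support, gives `∫ force·v + C_m·w`. Changing variables back to `B` yields `δC/δx = det(∂x/∂X) force
∘ x` and `δC/δM = C_m ∘ x` (`hasFunctionalDeriv_comp_toEulerF`). The canonical bracket becomes `∫
(force_C·D_m - force_D·C_m)` over `Ω`, whose integrand is that of the `F`-bracket up to a divergence
(`force_identity`). The flux is bilinear in the derivatives of `C` and `D`, so compact support of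
one of them removes it.

The displacement moves fields along curves that are not affine in `t`. The functional derivative is
taken along all smooth curves, so the chain rule needs no further regularity of `C`.

Passing from `F` to `A = F⁻¹` is a pointwise change of variables with `δA = -A δF A` and `∂A = -A
(∂F) A`. The brackets then agree integrand by integrand, without integration by parts and without a
support condition. The third assertion composes the first two. For the fourth, Leibniz' rule moves
every derivative off `C` (`evolution_identity`). Applied to smeared fields, whose functional
derivative is the test field itself, this and the fundamental lemma of the calculus of variations
give the evolution equations. No identity used relates the derivatives of different components of
`F` or `A`, so neither has to be a gradient. -/

theorem integrableOn_of_zero_off_compact {Ω K : Set Vec} (hΩ : IsOpen Ω) (hK : IsCompact K)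
    (hKΩ : K ⊆ Ω) {f : Vec → ℝ} (hf : ContinuousOn f Ω) (h0 : ∀ y ∈ Ω, y ∉ K → f y = 0) :
    IntegrableOn f Ω :=
  ((hf.mono hKΩ).integrableOn_compact hK).of_forall_sdiff_eq_zero hΩ.measurableSet
    fun y hy => h0 y hy.1 hy.2

/-- `IsVariation` demands smoothness on all of space, whereas the fields at hand are controlled only
on `Ω`. The open sets `Ω` and `Kᶜ` cover the space, and on the second the function vanishes. -/
theorem contDiffOn_univ_prod_of_zero_off {E F : Type*} [NormedAddCommGroup E] [NormedSpace ℝ E]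
    [NormedAddCommGroup F] [NormedSpace ℝ F] {I : Set ℝ} {Ω K : Set E}
    (hI : IsOpen I) (hΩ : IsOpen Ω) (hK : IsClosed K) (hKΩ : K ⊆ Ω) {f : ℝ × E → F}
    (hf : ContDiffOn ℝ ∞ f (I ×ˢ Ω)) (h0 : ∀ t ∈ I, ∀ y, y ∉ K → f (t, y) = 0) :
    ContDiffOn ℝ ∞ f (I ×ˢ univ) := by
  have h2 : ContDiffOn ℝ ∞ f (I ×ˢ Kᶜ) :=
    (contDiffOn_const (c := (0 : F))).congr fun p hp => h0 p.1 hp.1 p.2 hp.2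
  refine (hf.union_of_isOpen h2 (hI.prod hΩ) (hI.prod hK.isOpen_compl)).mono ?_
  rintro ⟨t, y⟩ ⟨ht, -⟩
  by_cases hy : y ∈ K
  · exact Or.inl ⟨ht, hKΩ hy⟩
  · exact Or.inr ⟨ht, hy⟩

theorem contDiff_indicator_of_zero_off {Ω K : Set Vec} (hΩ : IsOpen Ω) (hK : IsClosed K)
    (hKΩ : K ⊆ Ω) {f : Vec → ℝ} (hf : ContDiffOn ℝ ∞ f Ω) (h0 : ∀ y ∈ Ω, y ∉ K → f y = 0) :
    ContDiff ℝ ∞ (Ω.indicator f) := by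
  have h1 : ContDiffOn ℝ ∞ (Ω.indicator f) Ω := hf.congr fun y hy => indicator_of_mem hy f
  have h2 : ContDiffOn ℝ ∞ (Ω.indicator f) Kᶜ := by
    refine (contDiffOn_const (c := (0 : ℝ))).congr fun y hy => ?_
    by_cases hyΩ : y ∈ Ω
    · rw [indicator_of_mem hyΩ, h0 y hyΩ hy]
    · exact indicator_of_notMem hyΩ f
  rw [← contDiffOn_univ]
  refine (h1.union_of_isOpen h2 hΩ hK.isOpen_compl).mono ?_
  intro y _
  by_cases hy : y ∈ K
  · exact Or.inl (hKΩ hy)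
  · exact Or.inr hy

theorem hasDerivAt_slice {E F : Type*} [NormedAddCommGroup E] [NormedSpace ℝ E]
    [NormedAddCommGroup F] [NormedSpace ℝ F] {I : Set ℝ} {Ω : Set E} (hI : IsOpen I)
    (hΩ : IsOpen Ω) {ζ : ℝ → E → F} (hζ : ContDiffOn ℝ ∞ (Function.uncurry ζ) (I ×ˢ Ω))
    {t : ℝ} {y : E} (ht : t ∈ I) (hy : y ∈ Ω) :
    HasDerivAt (fun τ => ζ τ y) (fderiv ℝ (Function.uncurry ζ) (t, y) (1, 0)) t := by
  have hm : (t, y) ∈ I ×ˢ Ω := ⟨ht, hy⟩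
  have h1 := ((hζ.contDiffAt ((hI.prod hΩ).mem_nhds hm)).differentiableAt (by simp)).hasFDerivAt
  have h2 : HasDerivAt (fun τ : ℝ => (τ, y)) ((1 : ℝ), (0 : E)) t :=
    (hasDerivAt_id t).prodMk (hasDerivAt_const t y)
  exact h1.comp_hasDerivAt t h2

/-! ### Partial derivatives -/

theorem pd_congr {Ω : Set Vec} (hΩ : IsOpen Ω) {f g : Vec → ℝ} (h : EqOn f g Ω) (i : Fin 3)
    {y : Vec} (hy : y ∈ Ω) : pd i f y = pd i g y := by
  unfold pd
  rw [Filter.EventuallyEq.fderiv_eq (Filter.eventuallyEq_of_mem (hΩ.mem_nhds hy) h)]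

theorem pd_eq_zero {Ω K : Set Vec} (hΩ : IsOpen Ω) (hK : IsClosed K) {f : Vec → ℝ}
    (h0 : ∀ y ∈ Ω, y ∉ K → f y = 0) (i : Fin 3) {y : Vec} (hy : y ∈ Ω) (hyK : y ∉ K) :
    pd i f y = 0 := by
  rw [pd_congr (hΩ.inter hK.isOpen_compl) (g := fun _ => 0) (fun x hx => h0 x hx.1 hx.2) i ⟨hy, hyK⟩]
  simp [pd]

theorem contDiffOn_pd {Ω : Set Vec} (hΩ : IsOpen Ω) {f : Vec → ℝ} (hf : ContDiffOn ℝ ∞ f Ω)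
    (i : Fin 3) : ContDiffOn ℝ ∞ (pd i f) Ω :=
  (hf.fderiv_of_isOpen hΩ (m := ∞) le_rfl).clm_apply contDiffOn_const

theorem pd_mul {f g : Vec → ℝ} {y : Vec} (hf : DifferentiableAt ℝ f y)
    (hg : DifferentiableAt ℝ g y) (i : Fin 3) :
    pd i (fun x => f x * g x) y = pd i f y * g y + f y * pd i g y := by
  simp only [pd, fderiv_fun_mul hf hg]
  simp; ring

theorem pd_add {f g : Vec → ℝ} {y : Vec} (hf : DifferentiableAt ℝ f y)
    (hg : DifferentiableAt ℝ g y) (i : Fin 3) :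
    pd i (fun x => f x + g x) y = pd i f y + pd i g y := by
  simp [pd, fderiv_fun_add hf hg]

theorem pd_neg {f : Vec → ℝ} {y : Vec} (i : Fin 3) : pd i (fun x => - f x) y = - pd i f y := by
  simp [pd, fderiv_fun_neg]

theorem pd_sum {ι : Type*} [Fintype ι] {f : ι → Vec → ℝ} {y : Vec}
    (hf : ∀ k, DifferentiableAt ℝ (f k) y) (i : Fin 3) :
    pd i (fun x => ∑ k, f k x) y = ∑ k, pd i (f k) y := by
  simp [pd, fderiv_fun_sum fun k _ => hf k]

theorem vec_eq_sum (v : Vec) : v = ∑ i, v i • e i := by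
  ext j
  simp [e, Finset.sum_apply, Pi.single_apply]

theorem clm_apply_eq_sum {F : Type*} [NormedAddCommGroup F] [NormedSpace ℝ F] (L : Vec →L[ℝ] F)
    (v : Vec) : L v = ∑ i, v i • L (e i) := by
  conv_lhs => rw [vec_eq_sum v]
  simp

theorem fderiv_apply_eq_sum_pd (f : Vec → ℝ) (y v : Vec) :
    fderiv ℝ f y v = ∑ i, v i * pd i f y := by
  simp [clm_apply_eq_sum (fderiv ℝ f y) v, pd]

theorem integral_pd_eq_zero {Ω K : Set Vec} (hΩ : IsOpen Ω) (hK : IsCompact K)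
    (hKΩ : K ⊆ Ω) {f : Vec → ℝ} (hf : ContDiffOn ℝ ∞ f Ω) (h0 : ∀ y ∈ Ω, y ∉ K → f y = 0)
    (i : Fin 3) : ∫ y in Ω, pd i f y = 0 := by
  have hs := contDiff_indicator_of_zero_off hΩ hK.isClosed hKΩ hf h0
  have h0' : ∀ y, y ∉ K → Ω.indicator f y = 0 := fun y hy => by
    by_cases hyΩ : y ∈ Ω
    · rw [indicator_of_mem hyΩ, h0 y hyΩ hy]
    · exact indicator_of_notMem hyΩ f
  have hpd0 : ∀ y, y ∉ K → pd i (Ω.indicator f) y = 0 := fun y hy =>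
    pd_eq_zero isOpen_univ hK.isClosed (fun y _ hy => h0' y hy) i (mem_univ y) hy
  have hc : Continuous (pd i (Ω.indicator f)) := by
    rw [← continuousOn_univ]
    exact (contDiffOn_pd isOpen_univ (contDiffOn_univ.2 hs) i).continuousOn
  have hcs : HasCompactSupport (pd i (Ω.indicator f)) := HasCompactSupport.intro hK hpd0
  have hcs' : HasCompactSupport (Ω.indicator f) := HasCompactSupport.intro hK h0'
  -- Integration by parts against the constant function 1, for the extension of `f` by zero.
  have key := integral_mul_fderiv_eq_neg_fderiv_mul_of_integrable (𝕜 := ℝ) (μ := (volume : Measure Vec))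
    (f := fun _ => (1 : ℝ)) (g := Ω.indicator f) (v := e i) (by simp)
    (by simpa [pd] using! hc.integrable_of_hasCompactSupport hcs)
    (by simpa using hs.continuous.integrable_of_hasCompactSupport hcs')
    (by fun_prop) (fun x _ => hs.differentiable (by simp) x)
  calc ∫ y in Ω, pd i f y = ∫ y in Ω, pd i (Ω.indicator f) y :=
        setIntegral_congr_fun hΩ.measurableSet fun y hy =>
          pd_congr hΩ (fun x hx => (indicator_of_mem hx f).symm) i hy
    _ = ∫ y, pd i (Ω.indicator f) y :=
        setIntegral_eq_integral_of_forall_compl_eq_zero fun y hy => hpd0 y fun h => hy (hKΩ h)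
    _ = 0 := by simpa [pd] using key

/-- Two integrands that differ by the divergence of a smooth flux, compactly supported in `Ω`, have
the same integral. -/
theorem setIntegral_eq_of_sub_eq_div {Ω K : Set Vec} (hΩ : IsOpen Ω) (hK : IsCompact K)
    (hKΩ : K ⊆ Ω) {f g : Vec → ℝ} {Q : Fin 3 → Vec → ℝ} (hg : IntegrableOn g Ω)
    (hQ : ∀ i, ContDiffOn ℝ ∞ (Q i) Ω) (h0 : ∀ i, ∀ y ∈ Ω, y ∉ K → Q i y = 0)
    (h : ∀ y ∈ Ω, f y = g y + ∑ i, pd i (Q i) y) :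
    ∫ y in Ω, f y = ∫ y in Ω, g y := by
  have hint : ∀ i, IntegrableOn (pd i (Q i)) Ω := fun i =>
    integrableOn_of_zero_off_compact hΩ hK hKΩ (contDiffOn_pd hΩ (hQ i) i).continuousOn
      fun y hy hyK => pd_eq_zero hΩ hK.isClosed (h0 i) i hy hyK
  rw [setIntegral_congr_fun hΩ.measurableSet h, integral_add hg
    (integrable_finsetSum _ fun i _ => hint i), integral_finsetSum _ fun i _ => hint i]
  simp [integral_pd_eq_zero hΩ hK hKΩ (hQ _) (h0 _)]

/-- The fundamental lemma of the calculus of variations. -/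
theorem eqOn_of_forall_integral_mul_eq {U : Set Vec} (hU : IsOpen U) {f g : Vec → ℝ}
    (hf : ContinuousOn f U) (hg : ContinuousOn g U)
    (h : ∀ ψ : Vec → ℝ, ContDiff ℝ ∞ ψ → HasCompactSupport ψ → tsupport ψ ⊆ U →
      ∫ x in U, ψ x * f x = ∫ x in U, ψ x * g x) : EqOn f g U := by
  have hae : ∀ᵐ x ∂(volume : Measure Vec), x ∈ U → f x - g x = 0 := by
    refine hU.ae_eq_zero_of_integral_contDiff_smul_eq_zero
      ((hf.sub hg).locallyIntegrableOn hU.measurableSet) fun ψ hψ hc hs => ?_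
    have hz : ∀ x ∈ U, x ∉ tsupport ψ → ψ x = 0 := fun x _ hx => image_eq_zero_of_notMem_tsupport hx
    have i₁ : IntegrableOn (fun x => ψ x * f x) U := integrableOn_of_zero_off_compact hU hc hs
      (hψ.continuous.continuousOn.mul hf) fun x hx hxs => by simp [hz x hx hxs]
    have i₂ : IntegrableOn (fun x => ψ x * g x) U := integrableOn_of_zero_off_compact hU hc hs
      (hψ.continuous.continuousOn.mul hg) fun x hx hxs => by simp [hz x hx hxs]
    rw [← setIntegral_eq_integral_of_forall_compl_eq_zero (s := U) fun x hx => by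
      rw [image_eq_zero_of_notMem_tsupport fun h => hx (hs h), zero_smul]]
    simp only [smul_eq_mul, mul_sub]
    rw [integral_sub i₁ i₂, h ψ hψ hc hs, sub_self]
  refine Measure.eqOn_open_of_ae_eq (μ := (volume : Measure Vec)) ?_ hU hf hg
  rw [Filter.EventuallyEq, ae_restrict_iff' hU.measurableSet]
  filter_upwards [hae] with x hx hxU
  exact sub_eq_zero.1 (hx hxU)

/-! ### Functional derivatives -/

section FunctionalDerivative

variable {W : Type} [NormedAddCommGroup W] [NormedSpace ℝ W]

theorem isVariation_smul {U : Set Vec} {φ : Vec → W} (hφ : ContDiff ℝ ∞ φ)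
    (hc : HasCompactSupport φ) (hU : tsupport φ ⊆ U) : IsVariation U 1 fun t y => t • φ y := by
  refine ⟨one_pos, ?_, ⟨tsupport φ, hc, hU, fun t _ y hy => ?_⟩, ?_⟩
  · exact ContDiff.contDiffOn (by unfold Function.uncurry; fun_prop)
  · simp [image_eq_zero_of_notMem_tsupport hy]
  · ext y; simp

/-- Testing along the curves `t • ψ • w`, with `ψ` a scalar test function and `w` a fixed direction,
reduces uniqueness to the scalar fundamental lemma. Since `funcDeriv` is a choice, this is what
allows it to be computed, though only on `U`. -/
theorem HasFunctionalDeriv.eqOn {U : Set Vec} (hU : IsOpen U) {C : (Vec → W) → ℝ} {z : Vec → W}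
    {g₁ g₂ : Vec → W →L[ℝ] ℝ} (h₁ : HasFunctionalDeriv U C z g₁) (h₂ : HasFunctionalDeriv U C z g₂)
    (hg₁ : ContDiffOn ℝ ∞ g₁ U) (hg₂ : ContDiffOn ℝ ∞ g₂ U) : EqOn g₁ g₂ U := by
  intro y hy
  ext w
  refine eqOn_of_forall_integral_mul_eq hU (hg₁.clm_apply contDiffOn_const).continuousOn
    (hg₂.clm_apply contDiffOn_const).continuousOn (fun ψ hψ hc hs => ?_) hy
  have hsub : tsupport (fun x => ψ x • w) ⊆ tsupport ψ := tsupport_smul_subset_left ψ _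
  have hv := isVariation_smul (U := U) (φ := fun x => ψ x • w) (by fun_prop)
    (hc.smul_right) (hsub.trans hs)
  have heq := (h₁ _ _ hv).unique (h₂ _ _ hv)
  have hd : ∀ x : Vec, deriv (fun t : ℝ => t • ψ x • w) 0 = ψ x • w := fun x => by
    simpa using ((hasDerivAt_id (0 : ℝ)).smul_const (ψ x • w)).deriv
  simpa only [hd, map_smul, smul_eq_mul] using heq

theorem SmoothlyDifferentiableAt.contDiffOn {U : Set Vec} {C : (Vec → W) → ℝ} {z : Vec → W}
    (h : SmoothlyDifferentiableAt U C z) : ContDiffOn ℝ ∞ (funcDeriv U C z) U := by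
  rw [funcDeriv, dif_pos h]
  exact h.choose_spec.1

theorem SmoothlyDifferentiableAt.hasFunctionalDeriv {U : Set Vec} {C : (Vec → W) → ℝ} {z : Vec → W}
    (h : SmoothlyDifferentiableAt U C z) : HasFunctionalDeriv U C z (funcDeriv U C z) := by
  rw [funcDeriv, dif_pos h]
  exact h.choose_spec.2

theorem funcDeriv_eqOn {U : Set Vec} (hU : IsOpen U) {C : (Vec → W) → ℝ} {z : Vec → W}
    {g : Vec → W →L[ℝ] ℝ} (hg : ContDiffOn ℝ ∞ g U) (h : HasFunctionalDeriv U C z g) :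
    EqOn (funcDeriv U C z) g U :=
  have hs : SmoothlyDifferentiableAt U C z := ⟨g, hg, h⟩
  hs.hasFunctionalDeriv.eqOn hU h hs.contDiffOn hg

theorem SmoothlyDifferentiableAt.contDiffOn_apply {U : Set Vec} {C : (Vec → W) → ℝ} {z : Vec → W}
    (h : SmoothlyDifferentiableAt U C z) (w : W) :
    ContDiffOn ℝ ∞ (fun y => funcDeriv U C z y w) U :=
  h.contDiffOn.clm_apply contDiffOn_const

/-- Invertibility of perturbed tensors and of perturbed motions holds for short times only, so time
intervals have to be shrunk. -/
theorem IsVariation.mono {U : Set Vec} {ε δ : ℝ} {η : ℝ → Vec → W} (h : IsVariation U ε η)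
    (hδ : 0 < δ) (hδε : δ ≤ ε) : IsVariation U δ η := by
  obtain ⟨-, hs, ⟨K, hK, hKU, h0⟩, hz⟩ := h
  have hI : Ioo (-δ) δ ⊆ Ioo (-ε) ε := Ioo_subset_Ioo (neg_le_neg hδε) hδε
  exact ⟨hδ, hs.mono (prod_mono hI le_rfl), ⟨K, hK, hKU, fun t ht => h0 t (hI ht)⟩, hz⟩

theorem IsVariation.contDiffAt {U : Set Vec} {ε : ℝ} {η : ℝ → Vec → W} (h : IsVariation U ε η)
    {t : ℝ} (ht : t ∈ Ioo (-ε) ε) (y : Vec) : ContDiffAt ℝ ∞ (Function.uncurry η) (t, y) :=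
  h.2.1.contDiffAt ((isOpen_Ioo.prod isOpen_univ).mem_nhds ⟨ht, mem_univ y⟩)

theorem IsVariation.zero_mem {U : Set Vec} {ε : ℝ} {η : ℝ → Vec → W} (h : IsVariation U ε η) :
    (0 : ℝ) ∈ Ioo (-ε) ε := ⟨neg_lt_zero.2 h.1, h.1⟩

theorem IsVariation.hasDerivAt {U : Set Vec} {ε : ℝ} {η : ℝ → Vec → W} (h : IsVariation U ε η)
    {t : ℝ} (ht : t ∈ Ioo (-ε) ε) (y : Vec) :
    HasDerivAt (fun t => η t y) (fderiv ℝ (Function.uncurry η) (t, y) (1, 0)) t :=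
  hasDerivAt_slice isOpen_Ioo isOpen_univ h.2.1 ht (mem_univ y)

/-- The velocity of a variation is a smooth field. -/
theorem IsVariation.contDiff_deriv {U : Set Vec} {ε : ℝ} {η : ℝ → Vec → W}
    (h : IsVariation U ε η) : ContDiff ℝ ∞ fun y => deriv (fun t => η t y) 0 := by
  have h1 : ContDiffOn ℝ ∞ (fderiv ℝ (Function.uncurry η)) (Ioo (-ε) ε ×ˢ univ) :=
    h.2.1.fderiv_of_isOpen (isOpen_Ioo.prod isOpen_univ) (m := ∞) le_rfl
  have h2 : ContDiffOn ℝ ∞ (fun y : Vec => fderiv ℝ (Function.uncurry η) ((0 : ℝ), y) (1, 0)) univ :=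
    (h1.comp (t := Ioo (-ε) ε ×ˢ univ) (f := fun y : Vec => ((0 : ℝ), y)) (s := univ)
      (by fun_prop) fun y _ => ⟨h.zero_mem, mem_univ y⟩).clm_apply contDiffOn_const
  exact contDiffOn_univ.1 (h2.congr fun y _ => (h.hasDerivAt h.zero_mem y).deriv)

theorem IsVariation.deriv_eq_zero {K : Set Vec} {ε : ℝ} {η : ℝ → Vec → W} (hε : 0 < ε)
    (h0 : ∀ t ∈ Ioo (-ε) ε, ∀ y, y ∉ K → η t y = 0) {y : Vec} (hy : y ∉ K) :
    deriv (fun t => η t y) 0 = 0 := by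
  have : (fun t => η t y) =ᶠ[nhds 0] fun _ => 0 :=
    Filter.eventuallyEq_of_mem (Ioo_mem_nhds (neg_lt_zero.2 hε) hε) fun t ht => h0 t ht y hy
  rw [this.deriv_eq, deriv_const]

end FunctionalDerivative

/-! ### Components of Eulerian covectors -/

theorem mat_eq_sum (T : Mat3) : T = ∑ a, ∑ b, T a b • (Pi.single a (e b) : Mat3) := by
  ext i j
  simp only [Finset.sum_apply, Pi.smul_apply, Pi.single_apply, smul_eq_mul, e]
  fin_cases i <;> fin_cases j <;> simp [Fin.sum_univ_three]

theorem covector_apply (L : EState →L[ℝ] ℝ) (w : EState) :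
    L w = w.1 * L (1, 0, 0, 0) + ∑ i, w.2.1 i * L (0, e i, 0, 0) + w.2.2.1 * L (0, 0, 1, 0)
      + ∑ a, ∑ b, w.2.2.2 a b * L (0, 0, 0, Pi.single a (e b)) := by
  obtain ⟨r, m, s, T⟩ := w
  have h1 : ((r, m, s, T) : EState) = (r, 0, 0, 0) + (0, m, 0, 0) + (0, 0, s, 0) + (0, 0, 0, T) := by
    simp
  have hr : L (r, 0, 0, 0) = r * L (1, 0, 0, 0) := by
    rw [← smul_eq_mul, ← map_smul]; simp
  have hs : L (0, 0, s, 0) = s * L (0, 0, 1, 0) := by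
    rw [← smul_eq_mul, ← map_smul]; simp
  have hm : L (0, m, 0, 0) = ∑ i, m i * L (0, e i, 0, 0) :=
    clm_apply_eq_sum (L.comp (ContinuousLinearMap.inr ℝ ℝ (Vec × ℝ × Mat3) |>.comp
      (ContinuousLinearMap.inl ℝ Vec (ℝ × Mat3)))) m
  have hT : L (0, 0, 0, T) = ∑ a, ∑ b, T a b * L (0, 0, 0, Pi.single a (e b)) := by
    have h := congrArg (L.comp (ContinuousLinearMap.inr ℝ ℝ (Vec × ℝ × Mat3) |>.comp
      (ContinuousLinearMap.inr ℝ Vec (ℝ × Mat3) |>.comp (ContinuousLinearMap.inr ℝ ℝ Mat3))))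
      (mat_eq_sum T)
    simp only [map_sum, map_smul] at h
    simpa using! h
  conv_lhs => rw [h1, map_add, map_add, map_add, hr, hs, hm, hT]

/-! ### Pointwise changes of variables -/

section Pointwise

variable {W W' : Type} [NormedAddCommGroup W] [NormedSpace ℝ W]
  [NormedAddCommGroup W'] [NormedSpace ℝ W']

/-- Over a short time, a variation keeps a field with values in an open set within this set. -/
theorem IsVariation.exists_forall_add_mem {U : Set Vec} (hU : IsOpen U) {ε : ℝ} {η : ℝ → Vec → W}
    (h : IsVariation U ε η) {O : Set W} (hO : IsOpen O) {z : Vec → W} (hz : ContinuousOn z U)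
    (hzO : ∀ y ∈ U, z y ∈ O) :
    ∃ δ, 0 < δ ∧ δ ≤ ε ∧ ∀ t ∈ Ioo (-δ) δ, ∀ y ∈ U, z y + η t y ∈ O := by
  obtain ⟨hε, hs, ⟨K, hK, hKU, h0⟩, hη0⟩ := id h
  -- Compactness of `K` makes the admissible time uniform; off `K` the field does not move.
  have hev : ∀ᶠ t in nhds (0 : ℝ), ∀ y ∈ K, z y + η t y ∈ O := by
    refine hK.eventually_forall_of_forall_eventually fun y hy => ?_
    have c1 : ContinuousAt (fun p : ℝ × Vec => z p.2) (0, y) :=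
      ContinuousAt.comp (f := Prod.snd) (x := ((0 : ℝ), y)) (g := z)
        (hz.continuousAt (hU.mem_nhds (hKU hy))) continuousAt_snd
    have c2 := (h.contDiffAt h.zero_mem y).continuousAt
    have c3 : ContinuousAt (fun p : ℝ × Vec => z p.2 + η p.1 p.2) (0, y) := c1.add c2
    refine c3.preimage_mem_nhds (hO.mem_nhds ?_)
    simpa [hη0] using hzO y (hKU hy)
  obtain ⟨δ, hδ, hball⟩ := Metric.eventually_nhds_iff.1 hev
  refine ⟨min δ ε, lt_min hδ hε, min_le_right _ _, fun t ht y hy => ?_⟩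
  have ht' : t ∈ Ioo (-ε) ε :=
    Ioo_subset_Ioo (neg_le_neg (min_le_right _ _)) (min_le_right _ _) ht
  by_cases hyK : y ∈ K
  · refine hball ?_ y hyK
    rw [Real.dist_eq, sub_zero, abs_lt]
    exact ⟨(neg_le_neg (min_le_left _ _)).trans_lt ht.1, ht.2.trans_le (min_le_left _ _)⟩
  · rw [h0 t ht' y hyK, add_zero]
    exact hzO y hy

/-- The chain rule for functionals, under a pointwise change of the field variables. -/
theorem HasFunctionalDeriv.comp_pointwise {U : Set Vec} (hU : IsOpen U) {O : Set W}
    (hO : IsOpen O) {T : W → W'} (hT : ContDiffOn ℝ ∞ T O) {z : Vec → W}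
    (hz : ContDiffOn ℝ ∞ z U) (hzO : ∀ y ∈ U, z y ∈ O) {C : (Vec → W') → ℝ}
    {g : Vec → W' →L[ℝ] ℝ} (h : HasFunctionalDeriv U C (fun y => T (z y)) g) :
    HasFunctionalDeriv U (fun z => C fun y => T (z y)) z
      fun y => (g y).comp (fderiv ℝ T (z y)) := by
  intro ε η hη
  obtain ⟨δ, hδ, hδε, hmem⟩ := hη.exists_forall_add_mem hU hO hz.continuousOn hzO
  have hη' := hη.mono hδ hδε
  obtain ⟨-, hs, ⟨K, hK, hKU, h0⟩, hη0⟩ := id hη'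
  -- The image under `T` of even an affine curve of fields is curved. It is still an admissible
  -- variation of `T ∘ z`, so the derivative of `C` along it is known.
  have hvar : IsVariation U δ fun t y => T (z y + η t y) - T (z y) := by
    have hsupp : ∀ t ∈ Ioo (-δ) δ, ∀ y, y ∉ K → T (z y + η t y) - T (z y) = 0 :=
      fun t ht y hy => by simp [h0 t ht y hy]
    refine ⟨hδ, contDiffOn_univ_prod_of_zero_off isOpen_Ioo hU hK.isClosed hKU ?_ hsupp,
      ⟨K, hK, hKU, hsupp⟩, ?_⟩
    · have c1 : ContDiffOn ℝ ∞ (fun p : ℝ × Vec => z p.2) (Ioo (-δ) δ ×ˢ U) :=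
        hz.comp contDiffOn_snd fun p hp => hp.2
      have c2 : ContDiffOn ℝ ∞ (fun p : ℝ × Vec => η p.1 p.2) (Ioo (-δ) δ ×ˢ U) :=
        hs.mono (prod_mono le_rfl (subset_univ _))
      exact (hT.comp (c1.add c2) fun p hp => hmem p.1 hp.1 p.2 hp.2).sub
        (hT.comp c1 fun p hp => hzO p.2 hp.2)
    · ext y; simp [hη0]
  have key := h δ _ hvar
  have e1 : (fun t => C ((fun y => T (z y)) + fun y => T (z y + η t y) - T (z y)))
      = fun t => C fun y => T ((z + η t) y) := by
    funext t; congr 1; ext y; simp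
  rw [e1] at key
  convert key using 1
  refine setIntegral_congr_fun hU.measurableSet fun y hy => ?_
  have hd := (hη'.hasDerivAt hη'.zero_mem y).differentiableAt.hasDerivAt
  have hT' : HasFDerivAt T (fderiv ℝ T (z y)) (z y + η 0 y) := by
    rw [hη0, Pi.zero_apply, add_zero]
    exact ((hT.contDiffAt (hO.mem_nhds (hzO y hy))).differentiableAt (by simp)).hasFDerivAt
  have := (hT'.comp_hasDerivAt (0 : ℝ) (hd.const_add (z y))).sub_const (T (z y))
  simp only [Function.comp_def] at this
  simp [this.deriv]

theorem contDiffOn_comp_pointwise {U : Set Vec} {O : Set W}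
    (hO : IsOpen O) {T : W → W'} (hT : ContDiffOn ℝ ∞ T O) {z : Vec → W}
    (hz : ContDiffOn ℝ ∞ z U) (hzO : ∀ y ∈ U, z y ∈ O)
    {g : Vec → W' →L[ℝ] ℝ} (hg : ContDiffOn ℝ ∞ g U) :
    ContDiffOn ℝ ∞ (fun y => (g y).comp (fderiv ℝ T (z y))) U :=
  hg.clm_comp ((hT.fderiv_of_isOpen hO (m := ∞) le_rfl).comp hz hzO)

end Pointwise

/-! ### Inversion of three-by-three matrices -/

theorem contDiff_det : ContDiff ℝ ∞ fun T : Mat3 => (Matrix.of T).det := by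
  simp only [Matrix.det_fin_three, Matrix.of_apply]
  fun_prop

theorem contDiff_adjugate (a b : Fin 3) :
    ContDiff ℝ ∞ fun T : Mat3 => (Matrix.of T).adjugate a b := by
  simp only [Matrix.adjugate_fin_three, Matrix.of_apply]
  fin_cases a <;> fin_cases b <;> simp <;> fun_prop

theorem contDiffOn_inv : ContDiffOn ℝ ∞
    (fun T : Mat3 => (fun a b => (Matrix.of T)⁻¹ a b : Mat3)) {T | (Matrix.of T).det ≠ 0} := by
  simp only [Matrix.inv_def, Matrix.smul_apply, Ring.inverse_eq_inv', smul_eq_mul]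
  refine contDiffOn_pi.2 fun a => contDiffOn_pi.2 fun b => ?_
  exact (contDiff_det.contDiffOn.inv fun T hT => hT).mul (contDiff_adjugate a b).contDiffOn

theorem isOpen_det_ne_zero : IsOpen {T : Mat3 | (Matrix.of T).det ≠ 0} :=
  isOpen_ne_fun contDiff_det.continuous continuous_const

/-- Differentiating `T⁻¹ T = 1`, valid near `T`, gives `D(T⁻¹)[H] T = -T⁻¹ H`; it remains to
multiply by `T⁻¹` on the right. -/
theorem fderiv_inv_apply {T : Mat3} (hT : (Matrix.of T).det ≠ 0) (H : Mat3) (a b : Fin 3) :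
    fderiv ℝ (fun T : Mat3 => (fun a b => (Matrix.of T)⁻¹ a b : Mat3)) T H a b
      = - ((Matrix.of T)⁻¹ * Matrix.of H * (Matrix.of T)⁻¹) a b := by
  set inv : Mat3 → Mat3 := fun T => (fun a b => (Matrix.of T)⁻¹ a b : Mat3)
  have hd : HasFDerivAt inv (fderiv ℝ inv T) T :=
    ((contDiffOn_inv.contDiffAt (isOpen_det_ne_zero.mem_nhds hT)).differentiableAt
      (by simp)).hasFDerivAt
  have hu : IsUnit (Matrix.of T).det := hT.isUnit
  have hentry : ∀ a j, HasFDerivAt (fun T => inv T a j)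
      ((ContinuousLinearMap.proj j).comp ((ContinuousLinearMap.proj (R := ℝ) a).comp (fderiv ℝ inv T))) T :=
    fun a j => hasFDerivAt_pi'.1 (hasFDerivAt_pi'.1 hd a) j
  have hT' : ∀ j k, HasFDerivAt (fun T : Mat3 => T j k)
      ((ContinuousLinearMap.proj k).comp (ContinuousLinearMap.proj (R := ℝ) (φ := fun _ : Fin 3 => Vec) j)) T :=
    fun j k => ((ContinuousLinearMap.proj k).comp
      (ContinuousLinearMap.proj (R := ℝ) (φ := fun _ : Fin 3 => Vec) j)).hasFDerivAt
  have hprod : ∀ a k, ∑ j, (fderiv ℝ inv T H a j * T j k + inv T a j * H j k) = 0 := by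
    intro a k
    have h1 := HasFDerivAt.fun_sum (u := Finset.univ) fun j _ => (hentry a j).mul (hT' j k)
    have h2 : (fun T : Mat3 => ∑ j, inv T a j * T j k) =ᶠ[nhds T]
        fun _ => (1 : Matrix (Fin 3) (Fin 3) ℝ) a k := by
      filter_upwards [isOpen_det_ne_zero.mem_nhds hT] with S hS
      rw [← Matrix.nonsing_inv_mul (Matrix.of S) (IsUnit.mk0 _ hS), Matrix.mul_apply]
      rfl
    have h3 := h1.unique ((hasFDerivAt_const _ T).congr_of_eventuallyEq h2)
    have h4 := congrArg (fun L => L H) h3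
    simp at h4
    rw [← h4]
    exact Finset.sum_congr rfl fun j _ => by ring
  have hmat : Matrix.of (fderiv ℝ inv T H) * Matrix.of T
      = - ((Matrix.of T)⁻¹ * Matrix.of H) := by
    ext a k
    have := hprod a k
    rw [Finset.sum_add_distrib] at this
    rw [Matrix.neg_apply, Matrix.mul_apply, Matrix.mul_apply]
    exact eq_neg_of_add_eq_zero_left this
  have : Matrix.of (fderiv ℝ inv T H) = - ((Matrix.of T)⁻¹ * Matrix.of H * (Matrix.of T)⁻¹) := by
    rw [← Matrix.neg_mul, ← hmat, Matrix.mul_assoc, Matrix.mul_nonsing_inv _ hu, Matrix.mul_one]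
  exact congrFun (congrFun this a) b

/-! ### From the deformation gradient to the distortion -/

/-- The change of variables `(ρ, m, s, F) ↦ (ρ, m, s, F⁻¹)` at a point. -/
def distort (w : EState) : EState :=
  (w.1, w.2.1, w.2.2.1, fun L l => ((Matrix.of w.2.2.2)⁻¹ : Matrix _ _ ℝ) L l)

/-- The Eulerian states with an invertible tensor. -/
def regularStates : Set EState := {w | (Matrix.of w.2.2.2).det ≠ 0}

theorem isOpen_regularStates : IsOpen regularStates :=
  isOpen_det_ne_zero.preimage (f := fun w : EState => w.2.2.2) (by fun_prop)

theorem contDiffOn_distort : ContDiffOn ℝ ∞ distort regularStates := by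
  have h := contDiffOn_inv.comp (f := fun w : EState => w.2.2.2) (s := regularStates)
    (by fun_prop) fun w hw => hw
  exact contDiffOn_fst.prodMk ((by fun_prop : ContDiff ℝ ∞ fun w : EState => w.2.1).contDiffOn.prodMk
    ((by fun_prop : ContDiff ℝ ∞ fun w : EState => w.2.2.1).contDiffOn.prodMk h))

theorem fderiv_distort_apply {w : EState} (hw : w ∈ regularStates) (u : EState) :
    fderiv ℝ distort w u = (u.1, u.2.1, u.2.2.1, fun L l =>
      - ((Matrix.of w.2.2.2)⁻¹ * Matrix.of u.2.2.2 * (Matrix.of w.2.2.2)⁻¹) L l) := by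
  set inv : Mat3 → Mat3 := fun T => (fun a b => (Matrix.of T)⁻¹ a b : Mat3) with hinv
  have hd : HasFDerivAt inv (fderiv ℝ inv w.2.2.2) w.2.2.2 :=
    ((contDiffOn_inv.contDiffAt (isOpen_det_ne_zero.mem_nhds hw)).differentiableAt
      (by simp)).hasFDerivAt
  let p : EState →L[ℝ] Vec × ℝ × Mat3 := .snd ℝ _ _
  let p' : EState →L[ℝ] ℝ × Mat3 := (ContinuousLinearMap.snd ℝ _ _).comp p
  let p'' : EState →L[ℝ] Mat3 := (ContinuousLinearMap.snd ℝ _ _).comp p'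
  have h4 : HasFDerivAt (fun w : EState => inv w.2.2.2) ((fderiv ℝ inv w.2.2.2).comp p'') w :=
    HasFDerivAt.comp w (g := inv) (f := p'') hd p''.hasFDerivAt
  have h1 : HasFDerivAt (fun w : EState => w.1) (ContinuousLinearMap.fst ℝ _ _) w :=
    ContinuousLinearMap.hasFDerivAt (ContinuousLinearMap.fst ℝ ℝ (Vec × ℝ × Mat3))
  have h2 : HasFDerivAt (fun w : EState => w.2.1) ((ContinuousLinearMap.fst ℝ _ _).comp p) w :=
    ContinuousLinearMap.hasFDerivAt ((ContinuousLinearMap.fst ℝ Vec (ℝ × Mat3)).comp p)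
  have h3 : HasFDerivAt (fun w : EState => w.2.2.1) ((ContinuousLinearMap.fst ℝ _ _).comp p') w :=
    ContinuousLinearMap.hasFDerivAt ((ContinuousLinearMap.fst ℝ ℝ Mat3).comp p')
  have h : HasFDerivAt distort _ w := h1.prodMk (h2.prodMk (h3.prodMk h4))
  rw [h.fderiv]
  ext L l <;> simp [p, p', p'']
  exact fderiv_inv_apply hw _ L l

/-- Turns contractions with `C_F` or `C_A` into values of the functional derivative on a tensor
direction, where the chain rule applies directly. -/
theorem sum_mul_dTen (Ω : Set Vec) (C : (Vec → EState) → ℝ) (z : Vec → EState) (y : Vec)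
    (H : Mat3) : ∑ a, ∑ b, H a b * dTen Ω C z a b y = funcDeriv Ω C z y (0, 0, 0, H) := by
  rw [covector_apply (funcDeriv Ω C z y)]
  simp [dTen]

section Distortion

variable {Ω : Set Vec} (hΩ : IsOpen Ω) {z : Vec → EState} (hz : ContDiffOn ℝ ∞ z Ω)
  (hdet : ∀ y ∈ Ω, (Matrix.of (z y).2.2.2).det ≠ 0) {C D : (Vec → EState) → ℝ}

include hΩ hz hdet

/-- `toDistortion z` is definitionally `fun y => distort (z y)`, so this is an instance of the
pointwise chain rule. -/
theorem hasFunctionalDeriv_comp_toDistortion (hC : SmoothlyDifferentiableAt Ω C (toDistortion z)) :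
    HasFunctionalDeriv Ω (C ∘ toDistortion) z
      fun y => (funcDeriv Ω C (toDistortion z) y).comp (fderiv ℝ distort (z y)) :=
  hC.hasFunctionalDeriv.comp_pointwise hΩ isOpen_regularStates contDiffOn_distort hz hdet

theorem smoothlyDifferentiableAt_comp_toDistortion
    (hC : SmoothlyDifferentiableAt Ω C (toDistortion z)) :
    SmoothlyDifferentiableAt Ω (C ∘ toDistortion) z :=
  ⟨_, contDiffOn_comp_pointwise isOpen_regularStates contDiffOn_distort hz hdet hC.contDiffOn,
    hasFunctionalDeriv_comp_toDistortion hΩ hz hdet hC⟩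

theorem funcDeriv_comp_toDistortion (hC : SmoothlyDifferentiableAt Ω C (toDistortion z)) {y : Vec}
    (hy : y ∈ Ω) (u : EState) : funcDeriv Ω (C ∘ toDistortion) z y u
      = funcDeriv Ω C (toDistortion z) y (u.1, u.2.1, u.2.2.1, fun L l =>
      - ((Matrix.of (z y).2.2.2)⁻¹ * Matrix.of u.2.2.2 * (Matrix.of (z y).2.2.2)⁻¹) L l) := by
  rw [funcDeriv_eqOn hΩ
    (contDiffOn_comp_pointwise isOpen_regularStates contDiffOn_distort hz hdet hC.contDiffOn)
    (hasFunctionalDeriv_comp_toDistortion hΩ hz hdet hC) hy, ContinuousLinearMap.comp_apply,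
    fderiv_distort_apply (hdet y hy)]

theorem dRho_comp_toDistortion (hC : SmoothlyDifferentiableAt Ω C (toDistortion z)) :
    EqOn (dRho Ω (C ∘ toDistortion) z) (dRho Ω C (toDistortion z)) Ω := fun y hy => by
  simp only [dRho, funcDeriv_comp_toDistortion hΩ hz hdet hC hy]
  congr; ext; simp [Matrix.of_zero]

theorem dMo_comp_toDistortion (hC : SmoothlyDifferentiableAt Ω C (toDistortion z)) (i : Fin 3) :
    EqOn (dMo Ω (C ∘ toDistortion) z i) (dMo Ω C (toDistortion z) i) Ω := fun y hy => by
  simp only [dMo, funcDeriv_comp_toDistortion hΩ hz hdet hC hy]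
  congr; ext; simp [Matrix.of_zero]

theorem dEnt_comp_toDistortion (hC : SmoothlyDifferentiableAt Ω C (toDistortion z)) :
    EqOn (dEnt Ω (C ∘ toDistortion) z) (dEnt Ω C (toDistortion z)) Ω := fun y hy => by
  simp only [dEnt, funcDeriv_comp_toDistortion hΩ hz hdet hC hy]
  congr; ext; simp [Matrix.of_zero]

/-- The transformation of the covector `C_F` in dual form: a change `H` of `F` is the change `-A H
A` of `A`. The two kinds of tensor terms in the brackets arise from two choices of `H`. -/
theorem sum_mul_dTen_comp_toDistortion (hC : SmoothlyDifferentiableAt Ω C (toDistortion z))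
    {y : Vec} (hy : y ∈ Ω) (H : Mat3) :
    ∑ i, ∑ I, H i I * dTen Ω (C ∘ toDistortion) z i I y = ∑ L, ∑ l,
      - ((Matrix.of (z y).2.2.2)⁻¹ * Matrix.of H * (Matrix.of (z y).2.2.2)⁻¹) L l
        * dTen Ω C (toDistortion z) L l y := by
  rw [sum_mul_dTen, funcDeriv_comp_toDistortion hΩ hz hdet hC hy,
    sum_mul_dTen Ω C (toDistortion z) y fun L l =>
      - ((Matrix.of (z y).2.2.2)⁻¹ * Matrix.of H * (Matrix.of (z y).2.2.2)⁻¹) L l]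

theorem pd_ten_toDistortion {y : Vec} (hy : y ∈ Ω) (k L l : Fin 3) :
    pd k (ten (toDistortion z) L l) y = - ((Matrix.of (z y).2.2.2)⁻¹ *
      Matrix.of (fun i I => pd k (ten z i I) y) * (Matrix.of (z y).2.2.2)⁻¹) L l := by
  have hzd : HasFDerivAt z (fderiv ℝ z y) y :=
    ((hz.contDiffAt (hΩ.mem_nhds hy)).differentiableAt (by simp)).hasFDerivAt
  have hd : HasFDerivAt distort (fderiv ℝ distort (z y)) (z y) :=
    ((contDiffOn_distort.contDiffAt (isOpen_regularStates.mem_nhds (hdet y hy))).differentiableAt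
      (by simp)).hasFDerivAt
  let π (a b : Fin 3) : EState →L[ℝ] ℝ := (ContinuousLinearMap.proj b).comp
    ((ContinuousLinearMap.proj (R := ℝ) (φ := fun _ : Fin 3 => Vec) a).comp
    ((ContinuousLinearMap.snd ℝ ℝ Mat3).comp ((ContinuousLinearMap.snd ℝ Vec (ℝ × Mat3)).comp
      (ContinuousLinearMap.snd ℝ ℝ (Vec × ℝ × Mat3)))))
  have h1 : HasFDerivAt (ten (toDistortion z) L l) _ y :=
    (π L l).hasFDerivAt.comp y (hd.comp y hzd)
  have h2 : ∀ i I, HasFDerivAt (ten z i I) _ y := fun i I => (π i I).hasFDerivAt.comp y hzd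
  rw [pd, h1.fderiv]
  simp only [pd, (h2 _ _).fderiv, ContinuousLinearMap.comp_apply, fderiv_distort_apply (hdet y hy)]
  rfl

/-- Corresponding integrands agree at every point of `Ω`. The integrals are therefore equal one by
one, whether or not the integrands are integrable, and no support condition enters. -/
theorem bracketF_comp_toDistortion (hC : SmoothlyDifferentiableAt Ω C (toDistortion z))
    (hD : SmoothlyDifferentiableAt Ω D (toDistortion z)) :
    bracketF Ω (C ∘ toDistortion) (D ∘ toDistortion) z = bracketA Ω C D (toDistortion z) := by
  have hFA : ∀ y ∈ Ω, Matrix.of (z y).2.2.2 * (Matrix.of (z y).2.2.2)⁻¹ = 1 := fun y hy =>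
    Matrix.mul_nonsing_inv _ (hdet y hy).isUnit
  -- Stretching terms: `P` stands for the gradient of the other functional's `m`-derivative. The
  -- choice `H = P F` gives `-A (P F) A = -A P`, hence the opposite sign in the `A`-bracket.
  have hgrad : ∀ {E : (Vec → EState) → ℝ}, SmoothlyDifferentiableAt Ω E (toDistortion z) →
      ∀ y ∈ Ω, ∀ P : Mat3, ∑ i, ∑ j, ∑ I, ten z j I y * (dTen Ω (E ∘ toDistortion) z i I y * P i j)
        = - ∑ L, ∑ l, ∑ i, ten (toDistortion z) L i y * (dTen Ω E (toDistortion z) L l y * P i l) := by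
    intro E hE y hy P
    have h := sum_mul_dTen_comp_toDistortion hΩ hz hdet hE hy
      (fun i I => (Matrix.of P * Matrix.of (z y).2.2.2) i I)
    have hm : (Matrix.of (z y).2.2.2)⁻¹ * Matrix.of
        (fun i I => (Matrix.of P * Matrix.of (z y).2.2.2) i I) * (Matrix.of (z y).2.2.2)⁻¹
        = (Matrix.of (z y).2.2.2)⁻¹ * Matrix.of P := by
      change (Matrix.of (z y).2.2.2)⁻¹ * (Matrix.of P * Matrix.of (z y).2.2.2)
        * (Matrix.of (z y).2.2.2)⁻¹ = _
      rw [Matrix.mul_assoc, Matrix.mul_assoc, hFA y hy, Matrix.mul_one]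
    rw [hm] at h
    simp only [Matrix.mul_apply, Finset.sum_mul, neg_mul, Finset.sum_neg_distrib] at h
    calc _ = ∑ i, ∑ I, ∑ j, Matrix.of P i j * Matrix.of (z y).2.2.2 j I
            * dTen Ω (E ∘ toDistortion) z i I y := by
          refine Finset.sum_congr rfl fun i _ => ?_
          rw [Finset.sum_comm]
          refine Finset.sum_congr rfl fun I _ => Finset.sum_congr rfl fun j _ => ?_
          simp only [ten, Matrix.of_apply]; ring
      _ = _ := h
      _ = _ := by
          congr 1
          refine Finset.sum_congr rfl fun L _ => Finset.sum_congr rfl fun l _ =>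
            Finset.sum_congr rfl fun i _ => ?_
          simp only [ten, toDistortion, Matrix.of_apply]; ring
  -- Convective terms: for each `k` the choice `H = ∂_k F` gives `-A (∂_k F) A = ∂_k A`, so these
  -- terms keep their form. The sum over `k` is brought outside first.
  have htrans : ∀ {E : (Vec → EState) → ℝ}, SmoothlyDifferentiableAt Ω E (toDistortion z) →
      ∀ y ∈ Ω, ∀ v : Vec, ∑ i, ∑ I, ∑ k, pd k (ten z i I) y
          * (dTen Ω (E ∘ toDistortion) z i I y * v k)
        = ∑ L, ∑ l, ∑ i, pd i (ten (toDistortion z) L l) y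
          * (dTen Ω E (toDistortion z) L l y * v i) := by
    intro E hE y hy v
    have hsw : ∀ f : Fin 3 → Fin 3 → Fin 3 → ℝ,
        ∑ i, ∑ I, ∑ k, f i I k = ∑ k, ∑ i, ∑ I, f i I k := fun f => by
      rw [Finset.sum_congr rfl fun i _ => Finset.sum_comm, Finset.sum_comm]
    refine (hsw _).trans (Eq.trans ?_ (hsw _).symm)
    refine Finset.sum_congr rfl fun k _ => ?_
    simp only [pd_ten_toDistortion hΩ hz hdet hy, ← mul_assoc, ← Finset.sum_mul]
    rw [sum_mul_dTen_comp_toDistortion hΩ hz hdet hE hy]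
  unfold bracketF bracketA
  congr 1
  · rw [sub_eq_add_neg, ← integral_neg]
    congr 1
    · unfold bracketFM
      congr 1
      · congr 1
        · refine setIntegral_congr_fun hΩ.measurableSet fun y hy => ?_
          simp only [dMo_comp_toDistortion hΩ hz hdet hC _ hy, dMo_comp_toDistortion hΩ hz hdet hD _ hy,
            pd_congr hΩ (dRho_comp_toDistortion hΩ hz hdet hC) _ hy,
            pd_congr hΩ (dRho_comp_toDistortion hΩ hz hdet hD) _ hy]
          rfl
        · refine setIntegral_congr_fun hΩ.measurableSet fun y hy => ?_
          simp only [dMo_comp_toDistortion hΩ hz hdet hC _ hy, dMo_comp_toDistortion hΩ hz hdet hD _ hy,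
            pd_congr hΩ (dMo_comp_toDistortion hΩ hz hdet hC _) _ hy,
            pd_congr hΩ (dMo_comp_toDistortion hΩ hz hdet hD _) _ hy]
          rfl
      · refine setIntegral_congr_fun hΩ.measurableSet fun y hy => ?_
        simp only [dMo_comp_toDistortion hΩ hz hdet hC _ hy, dMo_comp_toDistortion hΩ hz hdet hD _ hy,
          pd_congr hΩ (dEnt_comp_toDistortion hΩ hz hdet hC) _ hy,
          pd_congr hΩ (dEnt_comp_toDistortion hΩ hz hdet hD) _ hy]
        rfl
    · refine setIntegral_congr_fun hΩ.measurableSet fun y hy => ?_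
      simp only [pd_congr hΩ (dMo_comp_toDistortion hΩ hz hdet hC _) _ hy,
        pd_congr hΩ (dMo_comp_toDistortion hΩ hz hdet hD _) _ hy, mul_sub, Finset.sum_sub_distrib]
      rw [hgrad hC y hy fun i j => pd j (dMo Ω D (toDistortion z) i) y,
        hgrad hD y hy fun i j => pd j (dMo Ω C (toDistortion z) i) y]
      ring
  · refine setIntegral_congr_fun hΩ.measurableSet fun y hy => ?_
    simp only [dMo_comp_toDistortion hΩ hz hdet hC _ hy, dMo_comp_toDistortion hΩ hz hdet hD _ hy,
      mul_sub, Finset.sum_sub_distrib]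
    rw [htrans hC y hy fun k => dMo Ω D (toDistortion z) k y,
      htrans hD y hy fun k => dMo Ω C (toDistortion z) k y]

end Distortion

/-! ### Components of Eulerian fields and of functional derivatives -/

section Components

variable {Ω : Set Vec} {z : Vec → EState} {C : (Vec → EState) → ℝ}

theorem contDiffOn_rho (hz : ContDiffOn ℝ ∞ z Ω) : ContDiffOn ℝ ∞ (rho z) Ω := hz.fst

theorem contDiffOn_mo (hz : ContDiffOn ℝ ∞ z Ω) (i : Fin 3) : ContDiffOn ℝ ∞ (mo z i) Ω :=
  contDiffOn_pi.1 hz.snd.fst i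

theorem contDiffOn_ent (hz : ContDiffOn ℝ ∞ z Ω) : ContDiffOn ℝ ∞ (ent z) Ω := hz.snd.snd.fst

theorem contDiffOn_ten (hz : ContDiffOn ℝ ∞ z Ω) (a b : Fin 3) : ContDiffOn ℝ ∞ (ten z a b) Ω :=
  contDiffOn_pi.1 (contDiffOn_pi.1 hz.snd.snd.snd a) b

variable (hC : SmoothlyDifferentiableAt Ω C z)

include hC in
theorem contDiffOn_dRho : ContDiffOn ℝ ∞ (dRho Ω C z) Ω := hC.contDiffOn_apply _

include hC in
theorem contDiffOn_dMo (i : Fin 3) : ContDiffOn ℝ ∞ (dMo Ω C z i) Ω := hC.contDiffOn_apply _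

include hC in
theorem contDiffOn_dEnt : ContDiffOn ℝ ∞ (dEnt Ω C z) Ω := hC.contDiffOn_apply _

include hC in
theorem contDiffOn_dTen (a b : Fin 3) : ContDiffOn ℝ ∞ (dTen Ω C z a b) Ω := hC.contDiffOn_apply _

theorem funcDeriv_apply (Ω : Set Vec) (C : (Vec → EState) → ℝ) (z : Vec → EState) (y : Vec)
    (w : EState) : funcDeriv Ω C z y w = dRho Ω C z y * w.1 + ∑ i, dMo Ω C z i y * w.2.1 i
      + dEnt Ω C z y * w.2.2.1 + ∑ a, ∑ b, dTen Ω C z a b y * w.2.2.2 a b := by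
  rw [covector_apply]
  simp only [dRho, dMo, dEnt, dTen, mul_comm]

/-- All components of the functional derivative, and their gradients, vanish at `y`. -/
def ComponentsVanish (Ω : Set Vec) (C : (Vec → EState) → ℝ) (z : Vec → EState) (y : Vec) : Prop :=
  (dRho Ω C z y = 0 ∧ (∀ i, dMo Ω C z i y = 0) ∧ dEnt Ω C z y = 0 ∧ ∀ a b, dTen Ω C z a b y = 0) ∧
    (∀ k, pd k (dRho Ω C z) y = 0) ∧ (∀ k i, pd k (dMo Ω C z i) y = 0) ∧
    (∀ k, pd k (dEnt Ω C z) y = 0) ∧ ∀ k a b, pd k (dTen Ω C z a b) y = 0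

/-- `Ω \ K` is open, so vanishing there passes to the gradients. -/
theorem componentsVanish_of_funcDeriv_eq_zero {K : Set Vec} (hΩ : IsOpen Ω) (hK : IsClosed K)
    (h : ∀ y ∈ Ω, y ∉ K → funcDeriv Ω C z y = 0) {y : Vec} (hy : y ∈ Ω) (hyK : y ∉ K) :
    ComponentsVanish Ω C z y := by
  have h' : ∀ w, ∀ y ∈ Ω, y ∉ K → funcDeriv Ω C z y w = 0 := fun w y hy hyK => by
    rw [h y hy hyK]; rfl
  exact ⟨⟨h' _ y hy hyK, fun i => h' _ y hy hyK, h' _ y hy hyK, fun a b => h' _ y hy hyK⟩,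
    fun k => pd_eq_zero hΩ hK (h' _) k hy hyK, fun k i => pd_eq_zero hΩ hK (h' _) k hy hyK,
    fun k => pd_eq_zero hΩ hK (h' _) k hy hyK, fun k a b => pd_eq_zero hΩ hK (h' _) k hy hyK⟩

end Components

/-! ### The brackets as single integrals -/

section Densities

variable (Ω : Set Vec) (C D : (Vec → EState) → ℝ) (z : Vec → EState) (y : Vec)

/-- The integrand of the bracket of fluid mechanics. -/
def densityFM : ℝ :=
  (∑ i, rho z y * (pd i (dRho Ω C z) y * dMo Ω D z i y - pd i (dRho Ω D z) y * dMo Ω C z i y))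
  + (∑ i, ∑ j, mo z i y *
    (pd j (dMo Ω C z i) y * dMo Ω D z j y - pd j (dMo Ω D z i) y * dMo Ω C z j y))
  + ∑ i, ent z y * (pd i (dEnt Ω C z) y * dMo Ω D z i y - pd i (dEnt Ω D z) y * dMo Ω C z i y)

/-- The integrand of the bracket for the deformation gradient. -/
def densityF : ℝ :=
  densityFM Ω C D z y
  + (∑ i, ∑ j, ∑ I, ten z j I y *
    (dTen Ω C z i I y * pd j (dMo Ω D z i) y - dTen Ω D z i I y * pd j (dMo Ω C z i) y))
  - ∑ i, ∑ I, ∑ k, pd k (ten z i I) y *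
    (dTen Ω C z i I y * dMo Ω D z k y - dTen Ω D z i I y * dMo Ω C z k y)

/-- The integrand of the bracket for the distortion. -/
def densityA : ℝ :=
  densityFM Ω C D z y
  - (∑ L, ∑ l, ∑ i, ten z L i y *
    (dTen Ω C z L l y * pd l (dMo Ω D z i) y - dTen Ω D z L l y * pd l (dMo Ω C z i) y))
  - ∑ L, ∑ l, ∑ i, pd i (ten z L l) y *
    (dTen Ω C z L l y * dMo Ω D z i y - dTen Ω D z L l y * dMo Ω C z i y)

end Densities

section Integrals

variable {Ω K : Set Vec} {C D : (Vec → EState) → ℝ} {z : Vec → EState} (hΩ : IsOpen Ω)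
  (hK : IsCompact K) (hKΩ : K ⊆ Ω) (hz : ContDiffOn ℝ ∞ z Ω)
  (hC : SmoothlyDifferentiableAt Ω C z) (hD : SmoothlyDifferentiableAt Ω D z)
  (h0 : ∀ y ∈ Ω, y ∉ K → ComponentsVanish Ω C z y ∨ ComponentsVanish Ω D z y)

include hΩ hK hKΩ hz hC hD h0

/-- The brackets are sums of separate integrals, which may be merged only if each converges. Each
summand contains a derivative of `C` and one of `D` as factors, so it vanishes off `K` as soon as
the components of either do. -/
theorem integrableOn_bracketFM_terms :
    IntegrableOn (fun y => ∑ i, rho z y *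
      (pd i (dRho Ω C z) y * dMo Ω D z i y - pd i (dRho Ω D z) y * dMo Ω C z i y)) Ω ∧
    IntegrableOn (fun y => ∑ i, ∑ j, mo z i y *
      (pd j (dMo Ω C z i) y * dMo Ω D z j y - pd j (dMo Ω D z i) y * dMo Ω C z j y)) Ω ∧
    IntegrableOn (fun y => ∑ i, ent z y *
      (pd i (dEnt Ω C z) y * dMo Ω D z i y - pd i (dEnt Ω D z) y * dMo Ω C z i y)) Ω := by
  have c1 := (contDiffOn_rho hz).continuousOn
  have c2 := fun i => (contDiffOn_mo hz i).continuousOn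
  have c3 := (contDiffOn_ent hz).continuousOn
  have c4 := fun i => (contDiffOn_dMo hC i).continuousOn
  have c5 := fun i => (contDiffOn_dMo hD i).continuousOn
  have c6 := fun i => (contDiffOn_pd hΩ (contDiffOn_dRho hC) i).continuousOn
  have c7 := fun i => (contDiffOn_pd hΩ (contDiffOn_dRho hD) i).continuousOn
  have c8 := fun i => (contDiffOn_pd hΩ (contDiffOn_dEnt hC) i).continuousOn
  have c9 := fun i => (contDiffOn_pd hΩ (contDiffOn_dEnt hD) i).continuousOn
  have c10 := fun i j => (contDiffOn_pd hΩ (contDiffOn_dMo hC i) j).continuousOn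
  have c11 := fun i j => (contDiffOn_pd hΩ (contDiffOn_dMo hD i) j).continuousOn
  refine ⟨?_, ?_, ?_⟩
  · refine integrableOn_of_zero_off_compact hΩ hK hKΩ (continuousOn_finsetSum _ fun i _ =>
      c1.mul (((c6 i).mul (c5 i)).sub ((c7 i).mul (c4 i)))) fun y hy hyK => ?_
    rcases h0 y hy hyK with ⟨⟨h1, h2, h3, h4⟩, h5, h6, h7, h8⟩ | ⟨⟨h1, h2, h3, h4⟩, h5, h6, h7, h8⟩ <;>
      simp [h2, h5]
  · refine integrableOn_of_zero_off_compact hΩ hK hKΩ (continuousOn_finsetSum _ fun i _ =>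
      continuousOn_finsetSum _ fun j _ => (c2 i).mul
        (((c10 i j).mul (c5 j)).sub ((c11 i j).mul (c4 j)))) fun y hy hyK => ?_
    rcases h0 y hy hyK with ⟨⟨h1, h2, h3, h4⟩, h5, h6, h7, h8⟩ | ⟨⟨h1, h2, h3, h4⟩, h5, h6, h7, h8⟩ <;>
      simp [h2, h6]
  · refine integrableOn_of_zero_off_compact hΩ hK hKΩ (continuousOn_finsetSum _ fun i _ =>
      c3.mul (((c8 i).mul (c5 i)).sub ((c9 i).mul (c4 i)))) fun y hy hyK => ?_
    rcases h0 y hy hyK with ⟨⟨h1, h2, h3, h4⟩, h5, h6, h7, h8⟩ | ⟨⟨h1, h2, h3, h4⟩, h5, h6, h7, h8⟩ <;>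
      simp [h2, h7]

theorem integrableOn_densityFM : IntegrableOn (densityFM Ω C D z) Ω := by
  obtain ⟨i1, i2, i3⟩ := integrableOn_bracketFM_terms hΩ hK hKΩ hz hC hD h0
  exact (i1.add i2).add i3

theorem bracketFM_eq_integral : bracketFM Ω C D z = ∫ y in Ω, densityFM Ω C D z y := by
  obtain ⟨i1, i2, i3⟩ := integrableOn_bracketFM_terms hΩ hK hKΩ hz hC hD h0
  unfold bracketFM densityFM
  rw [← integral_add i1 i2]
  exact (integral_add (i1.add i2) i3).symm

theorem integrableOn_bracketF_terms :
    IntegrableOn (fun y => ∑ i, ∑ j, ∑ I, ten z j I y *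
      (dTen Ω C z i I y * pd j (dMo Ω D z i) y - dTen Ω D z i I y * pd j (dMo Ω C z i) y)) Ω ∧
    IntegrableOn (fun y => ∑ i, ∑ I, ∑ k, pd k (ten z i I) y *
      (dTen Ω C z i I y * dMo Ω D z k y - dTen Ω D z i I y * dMo Ω C z k y)) Ω := by
  have c1 := fun i j => (contDiffOn_ten hz i j).continuousOn
  have c2 := fun i j k => (contDiffOn_pd hΩ (contDiffOn_ten hz i j) k).continuousOn
  have c4 := fun i => (contDiffOn_dMo hC i).continuousOn
  have c5 := fun i => (contDiffOn_dMo hD i).continuousOn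
  have c6 := fun i j => (contDiffOn_dTen hC i j).continuousOn
  have c7 := fun i j => (contDiffOn_dTen hD i j).continuousOn
  have c10 := fun i j => (contDiffOn_pd hΩ (contDiffOn_dMo hC i) j).continuousOn
  have c11 := fun i j => (contDiffOn_pd hΩ (contDiffOn_dMo hD i) j).continuousOn
  constructor
  · refine integrableOn_of_zero_off_compact hΩ hK hKΩ (continuousOn_finsetSum _ fun i _ =>
      continuousOn_finsetSum _ fun j _ => continuousOn_finsetSum _ fun I _ => (c1 j I).mul
        (((c6 i I).mul (c11 i j)).sub ((c7 i I).mul (c10 i j)))) fun y hy hyK => ?_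
    rcases h0 y hy hyK with ⟨⟨h1, h2, h3, h4⟩, h5, h6, h7, h8⟩ | ⟨⟨h1, h2, h3, h4⟩, h5, h6, h7, h8⟩ <;>
      simp [h4, h6]
  · refine integrableOn_of_zero_off_compact hΩ hK hKΩ (continuousOn_finsetSum _ fun i _ =>
      continuousOn_finsetSum _ fun I _ => continuousOn_finsetSum _ fun k _ => (c2 i I k).mul
        (((c6 i I).mul (c5 k)).sub ((c7 i I).mul (c4 k)))) fun y hy hyK => ?_
    rcases h0 y hy hyK with ⟨⟨h1, h2, h3, h4⟩, h5, h6, h7, h8⟩ | ⟨⟨h1, h2, h3, h4⟩, h5, h6, h7, h8⟩ <;>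
      simp [h4, h2]

theorem integrableOn_densityF : IntegrableOn (densityF Ω C D z) Ω := by
  obtain ⟨i1, i2⟩ := integrableOn_bracketF_terms hΩ hK hKΩ hz hC hD h0
  exact ((integrableOn_densityFM hΩ hK hKΩ hz hC hD h0).add i1).sub i2

theorem bracketF_eq_integral : bracketF Ω C D z = ∫ y in Ω, densityF Ω C D z y := by
  obtain ⟨i1, i2⟩ := integrableOn_bracketF_terms hΩ hK hKΩ hz hC hD h0
  have i0 := integrableOn_densityFM hΩ hK hKΩ hz hC hD h0
  unfold bracketF densityF
  rw [bracketFM_eq_integral hΩ hK hKΩ hz hC hD h0, ← integral_add i0 i1]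
  exact (integral_sub (i0.add i1) i2).symm

theorem integrableOn_bracketA_terms :
    IntegrableOn (fun y => ∑ L, ∑ l, ∑ i, ten z L i y *
      (dTen Ω C z L l y * pd l (dMo Ω D z i) y - dTen Ω D z L l y * pd l (dMo Ω C z i) y)) Ω ∧
    IntegrableOn (fun y => ∑ L, ∑ l, ∑ i, pd i (ten z L l) y *
      (dTen Ω C z L l y * dMo Ω D z i y - dTen Ω D z L l y * dMo Ω C z i y)) Ω := by
  -- The convective integrals of the two brackets differ only in the names of bound indices.
  refine ⟨?_, (integrableOn_bracketF_terms hΩ hK hKΩ hz hC hD h0).2⟩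
  have c1 := fun i j => (contDiffOn_ten hz i j).continuousOn
  have c6 := fun i j => (contDiffOn_dTen hC i j).continuousOn
  have c7 := fun i j => (contDiffOn_dTen hD i j).continuousOn
  have c10 := fun i j => (contDiffOn_pd hΩ (contDiffOn_dMo hC i) j).continuousOn
  have c11 := fun i j => (contDiffOn_pd hΩ (contDiffOn_dMo hD i) j).continuousOn
  refine integrableOn_of_zero_off_compact hΩ hK hKΩ (continuousOn_finsetSum _ fun L _ =>
    continuousOn_finsetSum _ fun l _ => continuousOn_finsetSum _ fun i _ => (c1 L i).mul
      (((c6 L l).mul (c11 i l)).sub ((c7 L l).mul (c10 i l)))) fun y hy hyK => ?_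
  rcases h0 y hy hyK with ⟨⟨h1, h2, h3, h4⟩, h5, h6, h7, h8⟩ | ⟨⟨h1, h2, h3, h4⟩, h5, h6, h7, h8⟩ <;>
    simp [h4, h6]

theorem bracketA_eq_integral : bracketA Ω C D z = ∫ y in Ω, densityA Ω C D z y := by
  obtain ⟨i1, i2⟩ := integrableOn_bracketA_terms hΩ hK hKΩ hz hC hD h0
  have i0 := integrableOn_densityFM hΩ hK hKΩ hz hC hD h0
  unfold bracketA densityA
  rw [bracketFM_eq_integral hΩ hK hKΩ hz hC hD h0, ← integral_sub i0 i1]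
  exact (integral_sub (i0.sub i1) i2).symm

end Integrals

theorem exists_componentsVanish {Ω : Set Vec} {C D : (Vec → EState) → ℝ} {z : Vec → EState}
    (hΩ : IsOpen Ω) (h : CompactlySupportedDeriv Ω C z ∨ CompactlySupportedDeriv Ω D z) :
    ∃ K, IsCompact K ∧ K ⊆ Ω ∧
      ∀ y ∈ Ω, y ∉ K → ComponentsVanish Ω C z y ∨ ComponentsVanish Ω D z y := by
  rcases h with ⟨K, hK, hKΩ, h⟩ | ⟨K, hK, hKΩ, h⟩
  · exact ⟨K, hK, hKΩ, fun y hy hyK =>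
      Or.inl (componentsVanish_of_funcDeriv_eq_zero hΩ hK.isClosed h hy hyK)⟩
  · exact ⟨K, hK, hKΩ, fun y hy hyK =>
      Or.inr (componentsVanish_of_funcDeriv_eq_zero hΩ hK.isClosed h hy hyK)⟩

/-! ### The evolution equations -/

/-- Pure Leibniz rule. The flux consists of `C_ρ ρ + C_m·m + C_s s`, carried by `E_m`, and of the
stress part `C_{m_i} A^L_i E_{A^L_k}`. No derivative of `C_A` occurs, so `cA` need not be
differentiable. The antisymmetrized gradient of `A` in `R_A` is what remains of `-A ∂E_m - (∂A) E_m`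
once `-∂_l(A^L_i E_{m_i})` is split off. -/
theorem evolution_identity {r s cr cs er es : Vec → ℝ} {m cm em : Fin 3 → Vec → ℝ}
    {A cA eA : Fin 3 → Fin 3 → Vec → ℝ} {y : Vec}
    (hr : DifferentiableAt ℝ r y) (hs : DifferentiableAt ℝ s y)
    (hcr : DifferentiableAt ℝ cr y) (hcs : DifferentiableAt ℝ cs y)
    (hm : ∀ i, DifferentiableAt ℝ (m i) y) (hcm : ∀ i, DifferentiableAt ℝ (cm i) y)
    (hem : ∀ i, DifferentiableAt ℝ (em i) y) (hA : ∀ a b, DifferentiableAt ℝ (A a b) y)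
    (heA : ∀ a b, DifferentiableAt ℝ (eA a b) y) :
    (∑ i, r y * (pd i cr y * em i y - pd i er y * cm i y))
    + (∑ i, ∑ j, m i y * (pd j (cm i) y * em j y - pd j (em i) y * cm j y))
    + (∑ i, s y * (pd i cs y * em i y - pd i es y * cm i y))
    - (∑ L, ∑ l, ∑ i, A L i y * (cA L l y * pd l (em i) y - eA L l y * pd l (cm i) y))
    - (∑ L, ∑ l, ∑ i, pd i (A L l) y * (cA L l y * em i y - eA L l y * cm i y))
    = (cr y * (- ∑ i, pd i (fun x => r x * em i x) y)
      + ∑ i, cm i y * (- (∑ j, pd j (fun x => m i x * em j x) y) - r y * pd i er y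
        - (∑ j, m j y * pd i (em j) y) - s y * pd i es y
        - (∑ L, ∑ l, A L l y * pd i (eA L l) y)
        + pd i (fun x => ∑ L, ∑ l, A L l x * eA L l x) y
        - ∑ l, pd l (fun x => ∑ L, A L i x * eA L l x) y)
      + cs y * (- ∑ i, pd i (fun x => s x * em i x) y)
      + ∑ L, ∑ l, cA L l y * (- pd l (fun x => ∑ i, A L i x * em i x) y
        + ∑ i, (pd l (A L i) y - pd i (A L l) y) * em i y))
      + ∑ k, pd k (fun x => cr x * (r x * em k x) + (∑ i, cm i x * (m i x * em k x))
        + cs x * (s x * em k x) + ∑ i, cm i x * ∑ L, A L i x * eA L k x) y := by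
  simp (disch := fun_prop) only [pd_mul, pd_sum, pd_add]
  simp only [Fin.sum_univ_three]
  ring


section Evolution

variable {Ω : Set Vec} (hΩ : IsOpen Ω) {z : Vec → EState} (hz : ContDiffOn ℝ ∞ z Ω)
  {C E : (Vec → EState) → ℝ} (hE : SmoothlyDifferentiableAt Ω E z)

include hΩ hz hE

theorem contDiffOn_evolutionA : ContDiffOn ℝ ∞ (evolutionA Ω E z) Ω := by
  have c1 := contDiffOn_rho hz
  have c2 := contDiffOn_mo hz
  have c3 := contDiffOn_ent hz
  have c4 := contDiffOn_ten hz
  have e1 := contDiffOn_dRho hE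
  have e2 := contDiffOn_dMo hE
  have e3 := contDiffOn_dEnt hE
  have e4 := contDiffOn_dTen hE
  refine ContDiffOn.prodMk ?_ (ContDiffOn.prodMk (contDiffOn_pi.2 fun i => ?_)
    (ContDiffOn.prodMk ?_ (contDiffOn_pi.2 fun L => contDiffOn_pi.2 fun l => ?_)))
  · exact (ContDiffOn.sum fun i _ => contDiffOn_pd hΩ (c1.mul (e2 i)) i).neg
  · refine ContDiffOn.sub (ContDiffOn.add (ContDiffOn.sub (ContDiffOn.sub (ContDiffOn.sub
      (ContDiffOn.sub (ContDiffOn.neg ?_) ?_) ?_) ?_) ?_) ?_) ?_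
    · exact ContDiffOn.sum fun j _ => contDiffOn_pd hΩ ((c2 i).mul (e2 j)) j
    · exact c1.mul (contDiffOn_pd hΩ e1 i)
    · exact ContDiffOn.sum fun j _ => (c2 j).mul (contDiffOn_pd hΩ (e2 j) i)
    · exact c3.mul (contDiffOn_pd hΩ e3 i)
    · exact ContDiffOn.sum fun L _ => ContDiffOn.sum fun l _ =>
        (c4 L l).mul (contDiffOn_pd hΩ (e4 L l) i)
    · exact contDiffOn_pd hΩ (ContDiffOn.sum fun L _ => ContDiffOn.sum fun l _ =>
        (c4 L l).mul (e4 L l)) i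
    · exact ContDiffOn.sum fun l _ => contDiffOn_pd hΩ (ContDiffOn.sum fun L _ =>
        (c4 L i).mul (e4 L l)) l
  · exact (ContDiffOn.sum fun i _ => contDiffOn_pd hΩ (c3.mul (e2 i)) i).neg
  · refine (contDiffOn_pd hΩ (ContDiffOn.sum fun i _ => (c4 L i).mul (e2 i)) l).neg.add
      (ContDiffOn.sum fun i _ => ContDiffOn.mul (ContDiffOn.sub ?_ ?_) (e2 i))
    · exact contDiffOn_pd hΩ (c4 L i) l
    · exact contDiffOn_pd hΩ (c4 L l) i

theorem bracketA_eq_integral_evolutionA (hC : SmoothlyDifferentiableAt Ω C z)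
    (hsupp : CompactlySupportedDeriv Ω C z ∨ CompactlySupportedDeriv Ω E z) :
    bracketA Ω C E z = ∫ y in Ω, funcDeriv Ω C z y (evolutionA Ω E z y) := by
  obtain ⟨K, hK, hKΩ, h0⟩ := exists_componentsVanish hΩ hsupp
  have hd : ∀ {f : Vec → ℝ}, ContDiffOn ℝ ∞ f Ω → ∀ y ∈ Ω, DifferentiableAt ℝ f y :=
    fun hf y hy => (hf.contDiffAt (hΩ.mem_nhds hy)).differentiableAt (by simp)
  have c1 := contDiffOn_rho hz
  have c2 := contDiffOn_mo hz
  have c3 := contDiffOn_ent hz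
  have c4 := contDiffOn_ten hz
  have d1 := contDiffOn_dRho hC
  have d2 := contDiffOn_dMo hC
  have d3 := contDiffOn_dEnt hC
  have e2 := contDiffOn_dMo hE
  have e4 := contDiffOn_dTen hE
  rw [bracketA_eq_integral hΩ hK hKΩ hz hC hE h0]
  have hid : ∀ y ∈ Ω, densityA Ω C E z y = funcDeriv Ω C z y (evolutionA Ω E z y)
      + ∑ k, pd k (fun x => dRho Ω C z x * (rho z x * dMo Ω E z k x)
        + (∑ i, dMo Ω C z i x * (mo z i x * dMo Ω E z k x))
        + dEnt Ω C z x * (ent z x * dMo Ω E z k x)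
        + ∑ i, dMo Ω C z i x * ∑ L, ten z L i x * dTen Ω E z L k x) y := by
    intro y hy
    rw [funcDeriv_apply]
    exact evolution_identity (hd c1 y hy) (hd c3 y hy) (hd d1 y hy) (hd d3 y hy)
      (fun i => hd (c2 i) y hy) (fun i => hd (d2 i) y hy) (fun i => hd (e2 i) y hy)
      (fun a b => hd (c4 a b) y hy) (fun a b => hd (e4 a b) y hy)
  have hQ : ∀ k, ContDiffOn ℝ ∞ (fun x => dRho Ω C z x * (rho z x * dMo Ω E z k x)
        + (∑ i, dMo Ω C z i x * (mo z i x * dMo Ω E z k x))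
        + dEnt Ω C z x * (ent z x * dMo Ω E z k x)
        + ∑ i, dMo Ω C z i x * ∑ L, ten z L i x * dTen Ω E z L k x) Ω := fun k =>
    (((d1.mul (c1.mul (e2 k))).add (ContDiffOn.sum fun i _ =>
      (d2 i).mul ((c2 i).mul (e2 k)))).add (d3.mul (c3.mul (e2 k)))).add
      (ContDiffOn.sum fun i _ => (d2 i).mul (ContDiffOn.sum fun L _ => (c4 L i).mul (e4 L k)))
  have hQ0 : ∀ k, ∀ y ∈ Ω, y ∉ K → dRho Ω C z y * (rho z y * dMo Ω E z k y)
        + (∑ i, dMo Ω C z i y * (mo z i y * dMo Ω E z k y))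
        + dEnt Ω C z y * (ent z y * dMo Ω E z k y)
        + ∑ i, dMo Ω C z i y * ∑ L, ten z L i y * dTen Ω E z L k y = 0 := fun k y hy hyK => by
    rcases h0 y hy hyK with ⟨⟨h1, h2, h3, h4⟩, -⟩ | ⟨⟨h1, h2, h3, h4⟩, -⟩ <;> simp [h1, h2, h3, h4]
  refine setIntegral_eq_of_sub_eq_div hΩ hK hKΩ ?_ hQ hQ0 hid
  -- Integrability of the new integrand follows by writing it as the bracket density minus the
  -- divergence, both of which are integrable.
  have i1 : IntegrableOn (densityA Ω C E z) Ω := by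
    obtain ⟨i1, i2⟩ := integrableOn_bracketA_terms hΩ hK hKΩ hz hC hE h0
    exact ((integrableOn_densityFM hΩ hK hKΩ hz hC hE h0).sub i1).sub i2
  refine (i1.sub (integrable_finsetSum Finset.univ fun k _ => integrableOn_of_zero_off_compact
    hΩ hK hKΩ (contDiffOn_pd hΩ (hQ k) k).continuousOn fun y hy hyK =>
      pd_eq_zero hΩ hK.isClosed (hQ0 k) k hy hyK)).congr ?_
  filter_upwards [ae_restrict_mem hΩ.measurableSet] with y hy
  simp only [Pi.sub_apply, hid y hy, add_sub_cancel_right]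

end Evolution

/-! ### Smeared fields -/

/-- Differentiation under the integral sign. -/
theorem hasDerivAt_integral_clm_apply {W : Type} [NormedAddCommGroup W] [NormedSpace ℝ W]
    {Ω K : Set Vec} {I : Set ℝ} (hI : IsOpen I) (hΩ : IsOpen Ω) (hK : IsCompact K) (hKΩ : K ⊆ Ω)
    {φ : Vec → W →L[ℝ] ℝ} (hφ : ContinuousOn φ Ω) (h0 : ∀ y ∈ Ω, y ∉ K → φ y = 0)
    {ζ : ℝ → Vec → W} (hζ : ContDiffOn ℝ ∞ (Function.uncurry ζ) (I ×ˢ Ω)) {t : ℝ} (ht : t ∈ I) :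
    HasDerivAt (fun τ => ∫ y in Ω, φ y (ζ τ y)) (∫ y in Ω, φ y (deriv (fun τ => ζ τ y) t)) t := by
  -- On `K` the measure is finite, and the time derivative is bounded on a closed interval times
  -- `K`; a constant then serves as dominating function.
  have hK0 : ∀ g : Vec → W, ∫ y in Ω, φ y (g y) = ∫ y in K, φ y (g y) := fun g =>
    setIntegral_eq_of_subset_of_forall_sdiff_eq_zero hΩ.measurableSet hKΩ fun y hy => by
      rw [h0 y hy.1 hy.2]; rfl
  simp only [hK0]
  have hderiv := fun τ hτ y hy => hasDerivAt_slice hI hΩ hζ (t := τ) (y := y) hτ hy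
  have hc' : ContinuousOn (fun p : ℝ × Vec => φ p.2 (fderiv ℝ (Function.uncurry ζ) p (1, 0)))
      (I ×ˢ Ω) :=
    (hφ.comp continuousOn_snd fun p hp => hp.2).clm_apply
      ((hζ.fderiv_of_isOpen (hI.prod hΩ) (m := ∞) le_rfl).continuousOn.clm_apply continuousOn_const)
  obtain ⟨r, hr, hrI⟩ := Metric.nhds_basis_closedBall.mem_iff.1 (hI.mem_nhds ht)
  obtain ⟨M, hM⟩ := ((isCompact_closedBall t r).prod hK).exists_bound_of_continuousOn
    (hc'.mono (prod_mono hrI hKΩ))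
  have hcont : ∀ τ ∈ I, ContinuousOn (fun y => φ y (ζ τ y)) K := fun τ hτ =>
    (hφ.mono hKΩ).clm_apply (hζ.continuousOn.comp (f := fun y : Vec => (τ, y)) (by fun_prop)
      fun y hy => ⟨hτ, hKΩ hy⟩)
  have key := hasDerivAt_integral_of_dominated_loc_of_deriv_le (μ := volume.restrict K)
    (F := fun τ y => φ y (ζ τ y)) (x₀ := t) (s := Metric.closedBall t r)
    (F' := fun τ y => φ y (fderiv ℝ (Function.uncurry ζ) (τ, y) (1, 0))) (bound := fun _ => M)
    (Metric.closedBall_mem_nhds t hr)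
    (Filter.eventually_of_mem (hI.mem_nhds ht) fun τ hτ =>
      (hcont τ hτ).aestronglyMeasurable hK.measurableSet)
    ((hcont t ht).integrableOn_compact hK)
    (ContinuousOn.aestronglyMeasurable
      (hc'.comp (f := fun y : Vec => (t, y)) (by fun_prop) fun y hy => ⟨ht, hKΩ hy⟩) hK.measurableSet)
    ((ae_restrict_iff' hK.measurableSet).2 (Filter.Eventually.of_forall fun y hy τ hτ =>
      hM (τ, y) ⟨hτ, hy⟩))
    (by
      have : IsFiniteMeasure (volume.restrict K) := ⟨by simpa using hK.measure_lt_top⟩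
      exact integrable_const M)
    ((ae_restrict_iff' hK.measurableSet).2 (Filter.Eventually.of_forall fun y hy τ hτ =>
      (φ y).hasFDerivAt.comp_hasDerivAt τ (hderiv τ (hrI hτ) y (hKΩ hy))))
  have hint : ∫ y in K, φ y (deriv (fun τ => ζ τ y) t)
      = ∫ y in K, φ y (fderiv ℝ (Function.uncurry ζ) (t, y) (1, 0)) :=
    setIntegral_congr_fun hK.measurableSet fun y hy => by
      simp only [(hderiv t ht y (hKΩ hy)).deriv]
  rw [hint]
  exact key.2

section Smeared

variable {Ω : Set Vec} (hΩ : IsOpen Ω) {φ : Vec → EState →L[ℝ] ℝ} (hφ : IsTest Ω φ)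

include hΩ hφ

theorem hasDerivAt_smeared {I : Set ℝ} (hI : IsOpen I) {ζ : ℝ → Vec → EState}
    (hζ : ContDiffOn ℝ ∞ (Function.uncurry ζ) (I ×ˢ Ω)) {t : ℝ} (ht : t ∈ I) :
    HasDerivAt (fun τ => smeared Ω φ (ζ τ)) (∫ y in Ω, φ y (deriv (fun τ => ζ τ y) t)) t :=
  hasDerivAt_integral_clm_apply hI hΩ hφ.2.1 hφ.2.2 hφ.1.continuous.continuousOn
    (fun _ _ hy => image_eq_zero_of_notMem_tsupport hy) hζ ht

/-- Smearing is linear in the field, so its functional derivative is `φ` at every `z`. In particular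
it has compact support, and the bracket with `E` needs no support condition on `E`. -/
theorem hasFunctionalDeriv_smeared {z : Vec → EState} (hz : ContDiffOn ℝ ∞ z Ω) :
    HasFunctionalDeriv Ω (smeared Ω φ) z φ := by
  intro ε η hη
  have h := hasDerivAt_smeared hΩ hφ isOpen_Ioo (I := Ioo (-ε) ε) (ζ := fun t => z + η t)
    ((hz.comp contDiffOn_snd fun p hp => hp.2).add (hη.2.1.mono (prod_mono le_rfl (subset_univ _))))
    hη.zero_mem
  simpa using h

theorem bracketA_smeared {z : Vec → EState} (hz : ContDiffOn ℝ ∞ z Ω) {E : (Vec → EState) → ℝ}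
    (hE : SmoothlyDifferentiableAt Ω E z) :
    bracketA Ω (smeared Ω φ) E z = ∫ y in Ω, φ y (evolutionA Ω E z y) := by
  have hf := hasFunctionalDeriv_smeared hΩ hφ hz
  have heq := funcDeriv_eqOn hΩ hφ.1.contDiffOn hf
  rw [bracketA_eq_integral_evolutionA hΩ hz hE ⟨φ, hφ.1.contDiffOn, hf⟩
    (Or.inl ⟨_, hφ.2.1, hφ.2.2, fun y hy hyK => by
      rw [heq hy, image_eq_zero_of_notMem_tsupport hyK]⟩)]
  exact setIntegral_congr_fun hΩ.measurableSet fun y hy => by simp only [heq hy]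

end Smeared

/-- The test fields `ψ • L`, with `L` a constant covector, reduce this to the scalar fundamental
lemma, since covectors separate points. -/
theorem eqOn_of_forall_integral_test_eq {Ω : Set Vec} (hΩ : IsOpen Ω) {f g : Vec → EState}
    (hf : ContinuousOn f Ω) (hg : ContinuousOn g Ω)
    (h : ∀ φ, IsTest Ω φ → ∫ y in Ω, φ y (f y) = ∫ y in Ω, φ y (g y)) : EqOn f g Ω := by
  intro y hy
  refine sub_eq_zero.1 ((SeparatingDual.eq_zero_iff_forall_dual_eq_zero (R := ℝ) _).2 fun L => ?_)
  rw [map_sub, sub_eq_zero]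
  refine eqOn_of_forall_integral_mul_eq (f := fun y => L (f y)) (g := fun y => L (g y)) hΩ
    (L.continuous.comp_continuousOn hf) (L.continuous.comp_continuousOn hg)
    (fun ψ hψ hc hs => ?_) hy
  exact h (fun x => ψ x • L) ⟨by fun_prop, hc.smul_right, (tsupport_smul_subset_left ψ _).trans hs⟩

/-- The smeared field has time derivative `∫ φ (∂_t z)` and its bracket with `E` is `∫ φ R`.
Equality for every test field is equality of the continuous fields `∂_t z` and `R`. -/
theorem evolution_iff {Ω : Set Vec} (hΩ : IsOpen Ω) {a b : ℝ} {z : ℝ → Vec → EState}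
    (hz : ContDiffOn ℝ ∞ (Function.uncurry z) (Ioo a b ×ˢ Ω)) {t : ℝ} (ht : t ∈ Ioo a b)
    {E : (Vec → EState) → ℝ} (hE : SmoothlyDifferentiableAt Ω E (z t)) :
    (∀ φ : Vec → EState →L[ℝ] ℝ, IsTest Ω φ →
      HasDerivAt (fun τ => smeared Ω φ (z τ)) (bracketA Ω (smeared Ω φ) E (z t)) t) ↔
    ∀ y ∈ Ω, HasDerivAt (fun τ => z τ y) (evolutionA Ω E (z t) y) t := by
  have hzt : ContDiffOn ℝ ∞ (z t) Ω :=
    hz.comp (f := fun y : Vec => (t, y)) (by fun_prop) fun y hy => ⟨ht, hy⟩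
  have hderiv := fun y hy => hasDerivAt_slice isOpen_Ioo hΩ hz (y := y) ht hy
  constructor
  · intro h y hy
    have hcont : ContinuousOn (fun y => deriv (fun τ => z τ y) t) Ω :=
      ContinuousOn.congr (f := fun y => fderiv ℝ (Function.uncurry z) (t, y) (1, 0))
        (((hz.fderiv_of_isOpen (isOpen_Ioo.prod hΩ) (m := ∞) le_rfl).continuousOn.comp
          (f := fun y : Vec => (t, y)) (by fun_prop) fun y hy => ⟨ht, hy⟩).clm_apply
          continuousOn_const) fun y hy => (hderiv y hy).deriv
    have heq := eqOn_of_forall_integral_test_eq hΩ hcont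
      (contDiffOn_evolutionA hΩ hzt hE).continuousOn (fun φ hφ => by
        rw [← bracketA_smeared hΩ hφ hzt hE]
        exact (hasDerivAt_smeared hΩ hφ isOpen_Ioo hz ht).unique (h φ hφ)) hy
    rw [← heq]
    exact (hderiv y hy).differentiableAt.hasDerivAt
  · intro h φ hφ
    rw [bracketA_smeared hΩ hφ hzt hE]
    have hint : ∫ y in Ω, φ y (deriv (fun τ => z τ y) t) = ∫ y in Ω, φ y (evolutionA Ω E (z t) y) :=
      setIntegral_congr_fun hΩ.measurableSet fun y hy => by simp only [(h y hy).deriv]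
    rw [← hint]
    exact hasDerivAt_smeared hΩ hφ isOpen_Ioo hz ht

/-! ### Smooth inverses -/

/-- A smooth injective map on an open set, with invertible derivatives, has an open image and a
smooth inverse. -/
theorem contDiffOn_invFunOn {E F : Type*} [NormedAddCommGroup E] [NormedSpace ℝ E]
    [CompleteSpace E] [NormedAddCommGroup F] [NormedSpace ℝ F] [CompleteSpace F] {f : E → F}
    {s : Set E} (hs : IsOpen s) (hf : ContDiffOn ℝ ∞ f s) (hinj : InjOn f s)
    (hf' : ∀ x ∈ s, ∃ f' : E ≃L[ℝ] F, HasFDerivAt f (f' : E →L[ℝ] F) x) :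
    IsOpen (f '' s) ∧ ContDiffOn ℝ ∞ (Function.invFunOn f s) (f '' s) := by
  have key : ∀ x ∈ s, f '' s ∈ nhds (f x) ∧ ContDiffAt ℝ ∞ (Function.invFunOn f s) (f x) := by
    intro x hx
    obtain ⟨f', hf'x⟩ := hf' x hx
    have hfx : ContDiffAt ℝ ∞ f x := hf.contDiffAt (hs.mem_nhds hx)
    have hstrict := hfx.hasStrictFDerivAt' hf'x (by simp)
    set g := hfx.localInverse hf'x (by simp) with hg
    have hgc : ContDiffAt ℝ ∞ g (f x) := hfx.to_localInverse hf'x (by simp)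
    have hgx : g (f x) = x := hfx.localInverse_apply_image hf'x (by simp)
    have hr : ∀ᶠ y in nhds (f x), f (g y) = y := hstrict.eventually_right_inverse
    have hgs : ∀ᶠ y in nhds (f x), g y ∈ s := by
      refine hgc.continuousAt.preimage_mem_nhds ?_
      rw [hgx]
      exact hs.mem_nhds hx
    constructor
    · filter_upwards [hr, hgs] with y h1 h2
      exact ⟨g y, h2, h1⟩
    -- Near `f x` the local inverse takes values in `s`, so injectivity of `f` on `s` identifies it
    -- with the global inverse.
    · refine hgc.congr_of_eventuallyEq ?_
      filter_upwards [hr, hgs] with y h1 h2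
      conv_lhs => rw [← h1]
      exact hinj.leftInvOn_invFunOn h2
  constructor
  · rw [isOpen_iff_mem_nhds]
    rintro _ ⟨x, hx, rfl⟩
    exact (key x hx).1
  · rintro _ ⟨x, hx, rfl⟩
    exact (key x hx).2.contDiffWithinAt

/-! ### Configurations -/

section Configuration

variable {B Ω : Set Vec} (hB : IsOpen B) {q : Vec → LState} (hq : IsConfiguration B Ω q)

include hq

theorem IsConfiguration.contDiffOn_pos : ContDiffOn ℝ ∞ (pos q) B := hq.smooth.fst

theorem IsConfiguration.pos_mem {X : Vec} (hX : X ∈ B) : pos q X ∈ Ω :=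
  hq.image ▸ mem_image_of_mem _ hX

theorem IsConfiguration.lab_mem {y : Vec} (hy : y ∈ Ω) : lab B q y ∈ B :=
  Function.invFunOn_mem (by rwa [← hq.image] at hy)

theorem IsConfiguration.pos_lab {y : Vec} (hy : y ∈ Ω) : pos q (lab B q y) = y :=
  Function.invFunOn_eq (by rwa [← hq.image] at hy)

theorem IsConfiguration.lab_pos {X : Vec} (hX : X ∈ B) : lab B q (pos q X) = X :=
  hq.injOn.leftInvOn_invFunOn hX

include hB

theorem IsConfiguration.hasFDerivAt_pos {X : Vec} (hX : X ∈ B) :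
    HasFDerivAt (pos q) (fderiv ℝ (pos q) X) X :=
  ((hq.contDiffOn_pos.contDiffAt (hB.mem_nhds hX)).differentiableAt (by simp)).hasFDerivAt

theorem IsConfiguration.contDiffOn_lab : ContDiffOn ℝ ∞ (lab B q) Ω := by
  rw [← hq.image]
  refine (contDiffOn_invFunOn hB hq.contDiffOn_pos hq.injOn fun X hX => ?_).2
  exact ⟨(fderiv ℝ (pos q) X).toContinuousLinearEquivOfDetNeZero (hq.det_pos X hX).ne',
    hq.hasFDerivAt_pos hB hX⟩

/-- Change of variables from the Lagrangian to the Eulerian frame. -/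
theorem IsConfiguration.setIntegral_eq (f : Vec → ℝ) :
    ∫ y in Ω, f y = ∫ X in B, (fderiv ℝ (pos q) X).det * f (pos q X) := by
  rw [← hq.image, integral_image_eq_integral_abs_det_fderiv_smul volume hB.measurableSet
    (fun X hX => (hq.hasFDerivAt_pos hB hX).hasFDerivWithinAt) hq.injOn]
  exact setIntegral_congr_fun hB.measurableSet fun X hX => by
    simp only [abs_of_pos (hq.det_pos X hX), smul_eq_mul]

variable (hΩ : IsOpen Ω)

include hΩ

theorem IsConfiguration.hasFDerivAt_lab {y : Vec} (hy : y ∈ Ω) :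
    HasFDerivAt (lab B q) (fderiv ℝ (lab B q) y) y :=
  (((hq.contDiffOn_lab hB).contDiffAt (hΩ.mem_nhds hy)).differentiableAt (by simp)).hasFDerivAt

theorem IsConfiguration.fderiv_pos_comp_fderiv_lab {y : Vec} (hy : y ∈ Ω) :
    (fderiv ℝ (pos q) (lab B q y)).comp (fderiv ℝ (lab B q) y) = ContinuousLinearMap.id ℝ Vec := by
  have h1 : HasFDerivAt (fun y => pos q (lab B q y)) _ y :=
    (hq.hasFDerivAt_pos hB (hq.lab_mem hy)).comp y (hq.hasFDerivAt_lab hB hΩ hy)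
  refine h1.unique ((hasFDerivAt_id y).congr_of_eventuallyEq ?_)
  exact Filter.eventuallyEq_of_mem (hΩ.mem_nhds hy) fun x hx => hq.pos_lab hx

theorem IsConfiguration.det_mul_det {y : Vec} (hy : y ∈ Ω) :
    (fderiv ℝ (pos q) (lab B q y)).det * (fderiv ℝ (lab B q) y).det = 1 := by
  have h := congrArg ContinuousLinearMap.det (hq.fderiv_pos_comp_fderiv_lab hB hΩ hy)
  have h1 : (ContinuousLinearMap.id ℝ Vec).det = 1 := LinearMap.det_id
  rw [h1] at h
  rw [← h]
  exact (LinearMap.det_comp _ _).symm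

end Configuration

/-! ### Spatial displacements close to the identity -/

theorem IsVariation.clm_comp {W W' : Type} [NormedAddCommGroup W] [NormedSpace ℝ W]
    [NormedAddCommGroup W'] [NormedSpace ℝ W'] {U : Set Vec} {ε : ℝ} {η : ℝ → Vec → W}
    (h : IsVariation U ε η) (L : W →L[ℝ] W') : IsVariation U ε fun t y => L (η t y) := by
  obtain ⟨hε, hs, ⟨K, hK, hKU, h0⟩, hz⟩ := h
  exact ⟨hε, L.contDiff.comp_contDiffOn hs, ⟨K, hK, hKU, fun t ht y hy => by
    simp [h0 t ht y hy]⟩, by ext y; simp [hz]⟩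

section Displacement

variable {Ω : Set Vec} {ε : ℝ} {h : ℝ → Vec → Vec}

theorem IsVariation.hasFDerivAt {W : Type} [NormedAddCommGroup W] [NormedSpace ℝ W]
    {η : ℝ → Vec → W} (hη : IsVariation Ω ε η) {t : ℝ} (ht : t ∈ Ioo (-ε) ε) (y : Vec) :
    HasFDerivAt (η t) ((fderiv ℝ (Function.uncurry η) (t, y)).comp
      (ContinuousLinearMap.inr ℝ ℝ Vec)) y := by
  have h1 := ((hη.contDiffAt ht y).differentiableAt (by simp)).hasFDerivAt
  exact h1.comp y (f := fun y : Vec => (t, y)) (hasFDerivAt_prodMk_right t y)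

theorem IsVariation.contDiffOn_fderiv {W : Type} [NormedAddCommGroup W] [NormedSpace ℝ W]
    {η : ℝ → Vec → W} (hη : IsVariation Ω ε η) :
    ContDiffOn ℝ ∞ (fun p : ℝ × Vec => fderiv ℝ (η p.1) p.2) (Ioo (-ε) ε ×ˢ univ) :=
  ((hη.2.1.fderiv_of_isOpen (isOpen_Ioo.prod isOpen_univ) (m := ∞) le_rfl).clm_comp
    contDiffOn_const).congr fun p hp => (hη.hasFDerivAt hp.1 p.2).fderiv

/-- The spatial derivative is zero at `t = 0` and jointly continuous, so it stays small uniformly on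
the compact support. Any bound below 1 would make `id + h t` invertible. -/
theorem IsVariation.exists_norm_fderiv_le (hh : IsVariation Ω ε h) :
    ∃ δ, 0 < δ ∧ δ ≤ ε ∧ ∀ t ∈ Ioo (-δ) δ, ∀ y, ‖fderiv ℝ (h t) y‖ ≤ 1 / 2 := by
  obtain ⟨hε, hs, ⟨K, hK, hKU, h0⟩, hz⟩ := id hh
  have hev : ∀ᶠ t in nhds (0 : ℝ), ∀ y ∈ K, ‖fderiv ℝ (h t) y‖ < 1 / 2 := by
    refine hK.eventually_forall_of_forall_eventually fun y hy => ?_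
    have hm : ((0 : ℝ), y) ∈ Ioo (-ε) ε ×ˢ (univ : Set Vec) := ⟨hh.zero_mem, mem_univ y⟩
    have c := (hh.contDiffOn_fderiv.continuousOn.continuousAt
      ((isOpen_Ioo.prod isOpen_univ).mem_nhds hm)).norm
    refine c.eventually_lt continuousAt_const ?_
    simp only [hz]
    simp
  obtain ⟨δ, hδ, hball⟩ := Metric.eventually_nhds_iff.1 hev
  refine ⟨min δ ε, lt_min hδ hε, min_le_right _ _, fun t ht y => ?_⟩
  by_cases hyK : y ∈ K
  · refine (hball ?_ y hyK).le
    rw [Real.dist_eq, sub_zero, abs_lt]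
    exact ⟨(neg_le_neg (min_le_left _ _)).trans_lt ht.1, ht.2.trans_le (min_le_left _ _)⟩
  · have ht' : t ∈ Ioo (-ε) ε :=
      Ioo_subset_Ioo (neg_le_neg (min_le_right _ _)) (min_le_right _ _) ht
    have : h t =ᶠ[nhds y] fun _ => 0 :=
      Filter.eventuallyEq_of_mem (hK.isClosed.isOpen_compl.mem_nhds hyK) fun x hx => h0 t ht' x hx
    rw [this.fderiv_eq]
    simp

/-- A perturbation of the identity with Lipschitz constant less than 1 is bijective. -/
theorem bijective_add_of_norm_fderiv_le {k : Vec → Vec} (hk : Differentiable ℝ k)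
    (hb : ∀ y, ‖fderiv ℝ k y‖ ≤ 1 / 2) : Function.Bijective fun x => x + k x := by
  have hl : LipschitzWith (1 / 2) k := lipschitzWith_of_nnnorm_fderiv_le hk fun x => by
    rw [← NNReal.coe_le_coe]
    simpa using hb x
  have ha : ApproximatesLinearOn (fun x => x + k x)
      (ContinuousLinearEquiv.refl ℝ Vec : Vec →L[ℝ] Vec) univ (1 / 2) := by
    refine fun x _ y _ => ?_
    have := hl.dist_le_mul x y
    rw [dist_eq_norm, dist_eq_norm] at this
    have he : x + k x - (y + k y) - (x - y) = k x - k y := by abel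
    simpa [he] using this
  have hc : Subsingleton Vec ∨
      (1 / 2 : NNReal) < ‖((ContinuousLinearEquiv.refl ℝ Vec).symm : Vec →L[ℝ] Vec)‖₊⁻¹ := by
    right
    have : ‖((ContinuousLinearEquiv.refl ℝ Vec).symm : Vec →L[ℝ] Vec)‖₊ = 1 :=
      NNReal.eq ContinuousLinearMap.norm_id
    rw [this, inv_one]
    exact NNReal.half_lt_self one_ne_zero
  exact ⟨injOn_univ.1 (ha.injOn hc), ha.surjective hc⟩

/-- The family `G t` of smooth inverses of the diffeomorphisms `x ↦ x + h t x`. -/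
structure IsInverseFlow (δ : ℝ) (h G : ℝ → Vec → Vec) : Prop where
  smooth : ContDiffOn ℝ ∞ (Function.uncurry G) (Ioo (-δ) δ ×ˢ univ)
  right_inv : ∀ t ∈ Ioo (-δ) δ, ∀ y, G t y + h t (G t y) = y
  left_inv : ∀ t ∈ Ioo (-δ) δ, ∀ x, G t (x + h t x) = x

/-- The inverse function theorem is applied to the space-time map `(t, x) ↦ (t, x + h t x)`, so that
the inverse is smooth jointly in time and space. -/
theorem IsVariation.exists_isInverseFlow (hh : IsVariation Ω ε h) :
    ∃ δ, 0 < δ ∧ δ ≤ ε ∧ ∃ G, IsInverseFlow δ h G := by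
  obtain ⟨δ, hδ, hδε, hb⟩ := hh.exists_norm_fderiv_le
  have hh' := hh.mono hδ hδε
  refine ⟨δ, hδ, hδε, ?_⟩
  have hbij : ∀ t ∈ Ioo (-δ) δ, Function.Bijective fun x => x + h t x := fun t ht =>
    bijective_add_of_norm_fderiv_le (fun y => (hh'.hasFDerivAt ht y).differentiableAt) (hb t ht)
  set S : Set (ℝ × Vec) := Ioo (-δ) δ ×ˢ univ with hS
  have hSo : IsOpen S := isOpen_Ioo.prod isOpen_univ
  set Ψ : ℝ × Vec → ℝ × Vec := fun p => (p.1, p.2 + Function.uncurry h p) with hΨ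
  have hΨs : ContDiffOn ℝ ∞ Ψ S := contDiffOn_fst.prodMk (contDiffOn_snd.add hh'.2.1)
  have hinj : InjOn Ψ S := by
    rintro ⟨t, x⟩ ⟨ht, -⟩ ⟨t', x'⟩ - heq
    obtain ⟨h1, h2⟩ := Prod.mk.inj heq
    simp only at h1 h2
    subst h1
    rw [(hbij t ht).1 h2]
  have himg : Ψ '' S = S := by
    refine Subset.antisymm ?_ ?_
    · rintro _ ⟨⟨t, x⟩, ⟨ht, -⟩, rfl⟩
      exact ⟨ht, mem_univ _⟩
    · rintro ⟨t, y⟩ ⟨ht, -⟩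
      obtain ⟨x, hx⟩ := (hbij t ht).2 y
      exact ⟨(t, x), ⟨ht, mem_univ _⟩, Prod.ext rfl hx⟩
  have hderiv : ∀ p ∈ S, ∃ f' : (ℝ × Vec) ≃L[ℝ] (ℝ × Vec),
      HasFDerivAt Ψ (f' : (ℝ × Vec) →L[ℝ] (ℝ × Vec)) p := by
    rintro ⟨t, x⟩ ⟨ht, hx⟩
    have h1 := ((hh'.contDiffAt ht x).differentiableAt (by simp)).hasFDerivAt
    have h2 : HasFDerivAt Ψ _ (t, x) := hasFDerivAt_fst.prodMk (hasFDerivAt_snd.add h1)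
    set L := (ContinuousLinearMap.fst ℝ ℝ Vec).prod
      (ContinuousLinearMap.snd ℝ ℝ Vec + fderiv ℝ (Function.uncurry h) (t, x)) with hL
    -- A kernel vector has zero time component and a space component `ξ = -Dh ξ`, whence `‖ξ‖ ≤ ‖ξ‖
    -- / 2`.
    have hLinj : Function.Injective (L : (ℝ × Vec) →ₗ[ℝ] (ℝ × Vec)) := by
      refine (injective_iff_map_eq_zero _).2 ?_
      rintro ⟨τ, ξ⟩ h0
      have h0' : (τ, ξ + fderiv ℝ (Function.uncurry h) (t, x) (τ, ξ)) = 0 := h0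
      obtain ⟨hτ, hξ⟩ := Prod.mk.inj h0'
      subst hτ
      have hfd : fderiv ℝ (Function.uncurry h) (t, x) (0, ξ) = fderiv ℝ (h t) x ξ := by
        rw [(hh'.hasFDerivAt ht x).fderiv]; rfl
      rw [hfd] at hξ
      have hle := (fderiv ℝ (h t) x).le_of_opNorm_le (hb t ht x) ξ
      have : ‖fderiv ℝ (h t) x ξ‖ = ‖ξ‖ := by
        rw [eq_neg_of_add_eq_zero_right hξ, norm_neg]
      rw [this] at hle
      have : ‖ξ‖ = 0 := le_antisymm (by linarith) (norm_nonneg _)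
      rw [norm_eq_zero.1 this]
      rfl
    refine ⟨(LinearEquiv.ofInjectiveEndo _ hLinj).toContinuousLinearEquiv, ?_⟩
    exact h2.congr_fderiv (ContinuousLinearMap.ext fun _ => rfl)
  have hinv := (contDiffOn_invFunOn hSo hΨs hinj hderiv).2
  rw [himg] at hinv
  have hfst : ∀ t ∈ Ioo (-δ) δ, ∀ y, ∃ x, x + h t x = y ∧ Function.invFunOn Ψ S (t, y) = (t, x) := by
    intro t ht y
    obtain ⟨x, hx⟩ := (hbij t ht).2 y
    refine ⟨x, hx, ?_⟩
    have hΨx : Ψ (t, x) = (t, y) := Prod.ext rfl hx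
    rw [← hΨx]
    exact hinj.leftInvOn_invFunOn ⟨ht, mem_univ x⟩
  refine ⟨fun t y => (Function.invFunOn Ψ S (t, y)).2, hinv.snd, fun t ht y => ?_, fun t ht x => ?_⟩
  · obtain ⟨x, hx, he⟩ := hfst t ht y
    simp only [he, hx]
  · obtain ⟨x', hx', he⟩ := hfst t ht (x + h t x)
    simp only [he]
    exact (hbij t ht).1 hx'

end Displacement

/-! ### Transport of Eulerian fields by a displacement -/

theorem clm_det_eq (L : Vec →L[ℝ] Vec) : L.det = (Matrix.of fun i j => L (e j) i).det := by
  rw [ContinuousLinearMap.det, ← LinearMap.det_toMatrix']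
  congr 1

theorem contDiff_clm_det : ContDiff ℝ ∞ fun L : Vec →L[ℝ] Vec => L.det := by
  simp only [clm_det_eq]
  refine contDiff_det.comp (f := fun L : Vec →L[ℝ] Vec => (fun i j => L (e j) i : Mat3)) ?_
  fun_prop

/-- The derivative of the determinant at the identity is the trace; this is the origin of the
divergence in the transport of densities. -/
theorem hasDerivAt_det_one_add {p : Fin 3 → Fin 3 → ℝ → ℝ} {p' : Fin 3 → Fin 3 → ℝ} {t : ℝ}
    (hp : ∀ i j, HasDerivAt (p i j) (p' i j) t) (h0 : ∀ i j, p i j t = 0) :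
    HasDerivAt (fun t => (1 + Matrix.of fun i j => p i j t).det) (∑ i, p' i i) t := by
  have a : ∀ i j, HasDerivAt (fun t => (1 : Matrix (Fin 3) (Fin 3) ℝ) i j + p i j t) (p' i j) t :=
    fun i j => (hp i j).const_add _
  have key := ((((((a 0 0).mul (a 1 1)).mul (a 2 2)).sub (((a 0 0).mul (a 1 2)).mul (a 2 1))).sub
    (((a 0 1).mul (a 1 0)).mul (a 2 2))).add (((a 0 1).mul (a 1 2)).mul (a 2 0))).add
    (((a 0 2).mul (a 1 0)).mul (a 2 1)) |>.sub (((a 0 2).mul (a 1 1)).mul (a 2 0))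
  refine (key.congr_deriv ?_).congr_of_eventuallyEq (Filter.Eventually.of_forall fun t => ?_)
  · simp [h0, Fin.sum_univ_three]
  · simp [Matrix.det_fin_three]

/-! ### Variations along moving points and their mixed derivatives -/

section Variations

variable {W : Type} [NormedAddCommGroup W] [NormedSpace ℝ W] {Ω : Set Vec} {ε : ℝ}
  {η : ℝ → Vec → W} (hη : IsVariation Ω ε η)

include hη

/-- At time zero, a variation evaluated along a moving point changes by its velocity. -/
theorem IsVariation.hasDerivAt_comp {c : ℝ → Vec} {c' y : Vec} (hc : HasDerivAt c c' 0)
    (hy : c 0 = y) : HasDerivAt (fun t => η t (c t)) (deriv (fun t => η t y) 0) 0 := by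
  subst hy
  have h1 := ((hη.contDiffAt hη.zero_mem (c 0)).differentiableAt (by simp)).hasFDerivAt
  have h2 := h1.comp_hasDerivAt (0 : ℝ) (f := fun t => (t, c t)) ((hasDerivAt_id (0 : ℝ)).prodMk hc)
  refine h2.congr_deriv ?_
  have h3 : ((1 : ℝ), c') = (1, 0) + ContinuousLinearMap.inr ℝ ℝ Vec c' := by simp
  -- The motion of the point contributes nothing, because `η 0` vanishes identically and so does its
  -- spatial derivative.
  have h4 : fderiv ℝ (Function.uncurry η) (0, c 0) (ContinuousLinearMap.inr ℝ ℝ Vec c') = 0 := by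
    have := (hη.hasFDerivAt hη.zero_mem (c 0)).unique
      (by rw [hη.2.2.2]; exact hasFDerivAt_const (0 : W) (c 0))
    exact congrArg (fun L => L c') this
  rw [h3, map_add, h4, add_zero, (hη.hasDerivAt hη.zero_mem (c 0)).deriv]

theorem IsVariation.fderiv_apply (u : Vec) :
    IsVariation Ω ε fun t y => fderiv ℝ (η t) y u := by
  obtain ⟨hε, hs, ⟨K, hK, hKU, h0⟩, hz⟩ := id hη
  refine ⟨hε, hη.contDiffOn_fderiv.clm_apply contDiffOn_const, ⟨K, hK, hKU, fun t ht y hy => ?_⟩, ?_⟩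
  · have : η t =ᶠ[nhds y] fun _ => 0 :=
      Filter.eventuallyEq_of_mem (hK.isClosed.isOpen_compl.mem_nhds hy) fun x hx => h0 t ht x hx
    simp [this.fderiv_eq]
  · ext y; simp [hz]

/-- The time derivative and the space derivatives of a variation commute. -/
theorem IsVariation.deriv_fderiv_apply (y u : Vec) :
    deriv (fun t => fderiv ℝ (η t) y u) 0 = fderiv ℝ (fun x => deriv (fun t => η t x) 0) y u := by
  set H := Function.uncurry η with hH
  have hc := hη.contDiffAt hη.zero_mem y
  have hd : HasFDerivAt (fderiv ℝ H) (fderiv ℝ (fderiv ℝ H) (0, y)) (0, y) :=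
    ((hc.fderiv_right (m := ∞) le_rfl).differentiableAt (by simp)).hasFDerivAt
  have h1 : HasDerivAt (fun t => fderiv ℝ H (t, y) (0, u))
      (fderiv ℝ (fderiv ℝ H) (0, y) (1, 0) (0, u)) 0 :=
    ((ContinuousLinearMap.apply ℝ W ((0 : ℝ), u)).hasFDerivAt.comp_hasDerivAt (0 : ℝ)
      (hd.comp_hasDerivAt (0 : ℝ) (f := fun t => (t, y))
        ((hasDerivAt_id (0 : ℝ)).prodMk (hasDerivAt_const (0 : ℝ) y))))
  have h2 : HasFDerivAt (fun x => fderiv ℝ H (0, x) (1, 0))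
      ((ContinuousLinearMap.apply ℝ W ((1 : ℝ), (0 : Vec))).comp
        ((fderiv ℝ (fderiv ℝ H) (0, y)).comp (ContinuousLinearMap.inr ℝ ℝ Vec))) y :=
    (ContinuousLinearMap.apply ℝ W ((1 : ℝ), (0 : Vec))).hasFDerivAt.comp y
      (hd.comp y (f := fun x => ((0 : ℝ), x)) (hasFDerivAt_prodMk_right (0 : ℝ) y))
  have e1 : (fun t => fderiv ℝ (η t) y u) =ᶠ[nhds 0] fun t => fderiv ℝ H (t, y) (0, u) := by
    filter_upwards [isOpen_Ioo.mem_nhds hη.zero_mem] with t ht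
    rw [(hη.hasFDerivAt ht y).fderiv]
    rfl
  have e2 : (fun x => deriv (fun t => η t x) 0) = fun x => fderiv ℝ H (0, x) (1, 0) := by
    funext x
    exact (hη.hasDerivAt hη.zero_mem x).deriv
  rw [e1.deriv_eq, h1.deriv, e2, h2.fderiv]
  exact (hc.isSymmSndFDerivAt (by simpa using WithTop.coe_le_coe.2 (le_top : (2 : ℕ∞) ≤ ⊤))).eq _ _

end Variations

/-! ### The inverse flow and its derivatives -/

section Flow

variable {Ω : Set Vec} {δ : ℝ} {h G : ℝ → Vec → Vec} (hG : IsInverseFlow δ h G)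

include hG

theorem IsInverseFlow.eq_self {t : ℝ} (ht : t ∈ Ioo (-δ) δ) {y : Vec} (h0 : h t y = 0) :
    G t y = y := by
  have := hG.left_inv t ht y
  rwa [h0, add_zero] at this

/-- Points outside `Ω` are not displaced, so `Ω` and its complement are both preserved. The deformed
body therefore still fills exactly `Ω`. -/
theorem IsInverseFlow.mem_iff (h0 : ∀ t ∈ Ioo (-δ) δ, ∀ y, y ∉ Ω → h t y = 0) {t : ℝ}
    (ht : t ∈ Ioo (-δ) δ) {y : Vec} : G t y ∈ Ω ↔ y ∈ Ω := by
  constructor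
  · intro hy
    by_contra hyΩ
    rw [hG.eq_self ht (h0 t ht y hyΩ)] at hy
    exact hyΩ hy
  · intro hy
    by_contra hyΩ
    have := hG.right_inv t ht y
    rw [h0 t ht _ hyΩ, add_zero] at this
    rw [this] at hyΩ
    exact hyΩ hy

variable (hh : IsVariation Ω δ h)

theorem IsInverseFlow.hasFDerivAt {t : ℝ} (ht : t ∈ Ioo (-δ) δ) (y : Vec) :
    HasFDerivAt (G t) (fderiv ℝ (G t) y) y := by
  have hm : (t, y) ∈ Ioo (-δ) δ ×ˢ (univ : Set Vec) := ⟨ht, mem_univ y⟩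
  have h1 := (hG.smooth.contDiffAt ((isOpen_Ioo.prod isOpen_univ).mem_nhds hm)).differentiableAt
    (by simp)
  have h2 : DifferentiableAt ℝ (G t) y :=
    h1.comp y (f := fun y : Vec => (t, y)) (by fun_prop)
  exact h2.hasFDerivAt

include hh

theorem IsInverseFlow.det_mul_det {t : ℝ} (ht : t ∈ Ioo (-δ) δ) (y : Vec) :
    (1 + Matrix.of fun i j => fderiv ℝ (h t) (G t y) (e j) i).det * (fderiv ℝ (G t) y).det = 1 := by
  have h1 : HasFDerivAt (fun x => x + h t x)
      (ContinuousLinearMap.id ℝ Vec + fderiv ℝ (h t) (G t y)) (G t y) :=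
    (hasFDerivAt_id _).add (hh.hasFDerivAt ht _).differentiableAt.hasFDerivAt
  have h2 : HasFDerivAt (fun y => G t y + h t (G t y)) _ y := h1.comp y (hG.hasFDerivAt ht y)
  have h3 := h2.unique ((hasFDerivAt_id y).congr_of_eventuallyEq
    (Filter.Eventually.of_forall (hG.right_inv t ht)))
  have h4 : (ContinuousLinearMap.id ℝ Vec + fderiv ℝ (h t) (G t y)).det
      = (1 + Matrix.of fun i j => fderiv ℝ (h t) (G t y) (e j) i).det := by
    rw [clm_det_eq]
    congr 1
    ext i j
    simp [e, Matrix.one_apply, Pi.single_apply]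
  have h5 := congrArg ContinuousLinearMap.det h3
  have h6 : (ContinuousLinearMap.id ℝ Vec).det = 1 := LinearMap.det_id
  rw [h6] at h5
  rw [← h4, ← h5]
  exact (LinearMap.det_comp _ _).symm

/-- Differentiate `G t y + h t (G t y) = y` at `t = 0`; the second term contributes only the
velocity of `h` at the fixed point `y`. -/
theorem IsInverseFlow.hasDerivAt (y : Vec) :
    HasDerivAt (fun t => G t y) (- deriv (fun t => h t y) 0) 0 := by
  have h1 := hasDerivAt_slice isOpen_Ioo isOpen_univ hG.smooth hh.zero_mem (mem_univ y)
  have hz : G 0 y = y := hG.eq_self hh.zero_mem (by rw [hh.2.2.2]; rfl)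
  have h2 := h1.add (hh.hasDerivAt_comp h1 hz)
  have h3 : (fun t => G t y + h t (G t y)) =ᶠ[nhds 0] fun _ => y :=
    Filter.eventuallyEq_of_mem (isOpen_Ioo.mem_nhds hh.zero_mem) fun t ht => hG.right_inv t ht y
  have h4 := h2.unique ((hasDerivAt_const (0 : ℝ) y).congr_of_eventuallyEq h3)
  exact h1.congr_deriv (eq_neg_of_add_eq_zero_left h4)

end Flow

/-- The volume ratio `det DG` of the inverse flow `G` of `x ↦ x + h t x`. -/
def dilation (h G : ℝ → Vec → Vec) (t : ℝ) (y : Vec) : ℝ :=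
  ((1 + Matrix.of fun i j => fderiv ℝ (h t) (G t y) (e j) i).det)⁻¹

/-- The Eulerian fields `z`, with momentum density increased by `μ`, transported by the
diffeomorphism `x ↦ x + h t x` with inverse `G t`. -/
def transport (z : Vec → EState) (h μ G : ℝ → Vec → Vec) (t : ℝ) (y : Vec) : EState :=
  (rho z (G t y) * dilation h G t y,
    fun i => dilation h G t y * (mo z i (G t y) + μ t (G t y) i),
    ent z (G t y) * dilation h G t y,
    fun i I => ten z i I (G t y) + ∑ j, ten z j I (G t y) * fderiv ℝ (h t) (G t y) (e j) i)

/-- The rate of change of the Eulerian fields `z` under a displacement with velocity `v`, and a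
momentum density supplied at the rate `w`. -/
def transportRate (z : Vec → EState) (v w : Vec → Vec) (y : Vec) : EState :=
  (- ∑ j, pd j (fun x => rho z x * v x j) y,
    fun i => - (∑ j, pd j (fun x => mo z i x * v x j) y) + w y i,
    - ∑ j, pd j (fun x => ent z x * v x j) y,
    fun i I => (∑ j, ten z j I y * pd j (fun x => v x i) y) - ∑ k, v y k * pd k (ten z i I) y)

section Transport

variable {Ω : Set Vec} {δ : ℝ} {h μ G : ℝ → Vec → Vec} {z : Vec → EState} (hΩ : IsOpen Ω)
  (hG : IsInverseFlow δ h G) (hh : IsVariation Ω δ h) (hμ : IsVariation Ω δ μ)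
  (hz : ContDiffOn ℝ ∞ z Ω)

include hG hh in
theorem contDiffOn_dilation :
    ContDiffOn ℝ ∞ (fun p : ℝ × Vec => dilation h G p.1 p.2) (Ioo (-δ) δ ×ˢ univ) := by
  refine ContDiffOn.inv ?_ fun p hp => left_ne_zero_of_mul_eq_one (hG.det_mul_det hh hp.1 p.2)
  refine contDiff_det.comp_contDiffOn (f := fun p : ℝ × Vec =>
    (fun i j => (1 : Matrix (Fin 3) (Fin 3) ℝ) i j + fderiv ℝ (h p.1) (G p.1 p.2) (e j) i : Mat3))
    (contDiffOn_pi.2 fun i => contDiffOn_pi.2 fun j => contDiffOn_const.add ?_)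
  exact contDiffOn_pi.1 ((hh.fderiv_apply (e j)).2.1.comp (f := fun p : ℝ × Vec => (p.1, G p.1 p.2))
    (contDiffOn_fst.prodMk hG.smooth) fun p hp => ⟨hp.1, mem_univ _⟩) i

include hΩ hG hh hμ hz

/-- Makes the transported fields an admissible curve through `z`, along which `C` can be
differentiated. The indicator is needed because `z` is smooth on `Ω` only; off the supports of `h`
and `μ` nothing changes. -/
theorem isVariation_transport :
    IsVariation Ω δ fun t => Ω.indicator fun y => transport z h μ G t y - z y := by
  obtain ⟨hδ, -, ⟨K₁, hK₁, hK₁Ω, h0⟩, hh0⟩ := id hh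
  obtain ⟨-, -, ⟨K₂, hK₂, hK₂Ω, μ0⟩, hμ0⟩ := id hμ
  have hfix : ∀ t ∈ Ioo (-δ) δ, ∀ y, h t y = 0 → (∀ j, fderiv ℝ (h t) y (e j) = 0) → μ t y = 0 →
      transport z h μ G t y = z y := by
    intro t ht y h1 h2 h3
    have h4 : (Matrix.of fun _ _ : Fin 3 => (0 : ℝ)) = 0 := rfl
    simp [transport, dilation, hG.eq_self ht h1, h2, h3, h4, rho, mo, ent, ten]
  have hsupp : ∀ t ∈ Ioo (-δ) δ, ∀ y, y ∉ K₁ ∪ K₂ →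
      Ω.indicator (fun y => transport z h μ G t y - z y) y = 0 := by
    intro t ht y hy
    by_cases hyΩ : y ∈ Ω
    · rw [indicator_of_mem hyΩ, sub_eq_zero]
      refine hfix t ht y (h0 t ht y fun h => hy (Or.inl h)) (fun j => ?_)
        (μ0 t ht y fun h => hy (Or.inr h))
      have : h t =ᶠ[nhds y] fun _ => 0 :=
        Filter.eventuallyEq_of_mem (hK₁.isClosed.isOpen_compl.mem_nhds fun h => hy (Or.inl h))
          fun x hx => h0 t ht x hx
      simp [this.fderiv_eq]
    · exact indicator_of_notMem hyΩ _
  refine ⟨hδ, contDiffOn_univ_prod_of_zero_off isOpen_Ioo hΩ (hK₁.union hK₂).isClosed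
    (union_subset hK₁Ω hK₂Ω) ?_ hsupp, ⟨_, hK₁.union hK₂, union_subset hK₁Ω hK₂Ω, hsupp⟩, ?_⟩
  · have hGΩ : ∀ p ∈ Ioo (-δ) δ ×ˢ Ω, G p.1 p.2 ∈ Ω := fun p hp =>
      (hG.mem_iff (fun t ht y hy => h0 t ht y fun hK => hy (hK₁Ω hK)) hp.1).2 hp.2
    have cG : ContDiffOn ℝ ∞ (fun p : ℝ × Vec => G p.1 p.2) (Ioo (-δ) δ ×ˢ Ω) :=
      hG.smooth.mono (prod_mono le_rfl (subset_univ _))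
    have cJ := (contDiffOn_dilation hG hh).mono (prod_mono le_rfl (subset_univ Ω))
    have cf : ∀ {f : Vec → ℝ}, ContDiffOn ℝ ∞ f Ω →
        ContDiffOn ℝ ∞ (fun p : ℝ × Vec => f (G p.1 p.2)) (Ioo (-δ) δ ×ˢ Ω) :=
      fun hf => hf.comp cG hGΩ
    have cp : ContDiffOn ℝ ∞ (fun p : ℝ × Vec => (p.1, G p.1 p.2)) (Ioo (-δ) δ ×ˢ Ω) :=
      contDiffOn_fst.prodMk cG
    have cμ : ∀ i, ContDiffOn ℝ ∞ (fun p : ℝ × Vec => μ p.1 (G p.1 p.2) i) (Ioo (-δ) δ ×ˢ Ω) :=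
      contDiffOn_pi.1 (hμ.2.1.comp cp fun p hp => ⟨hp.1, mem_univ _⟩)
    have ch : ∀ j i, ContDiffOn ℝ ∞ (fun p : ℝ × Vec => fderiv ℝ (h p.1) (G p.1 p.2) (e j) i)
        (Ioo (-δ) δ ×ˢ Ω) := fun j =>
      contDiffOn_pi.1 ((hh.fderiv_apply (e j)).2.1.comp cp fun p hp => ⟨hp.1, mem_univ _⟩)
    have ct : ContDiffOn ℝ ∞ (fun p : ℝ × Vec => transport z h μ G p.1 p.2) (Ioo (-δ) δ ×ˢ Ω) :=
      ((cf (contDiffOn_rho hz)).mul cJ).prodMk ((contDiffOn_pi.2 fun i =>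
        cJ.mul ((cf (contDiffOn_mo hz i)).add (cμ i))).prodMk
        (((cf (contDiffOn_ent hz)).mul cJ).prodMk (contDiffOn_pi.2 fun i => contDiffOn_pi.2 fun I =>
          (cf (contDiffOn_ten hz i I)).add (ContDiffOn.sum fun j _ =>
            (cf (contDiffOn_ten hz j I)).mul (ch j i)))))
    exact (ct.sub (hz.comp contDiffOn_snd fun p hp => hp.2)).congr fun p hp =>
      indicator_of_mem hp.2 fun y => transport z h μ G p.1 y - z y
  · ext1 y
    change Ω.indicator (fun y => transport z h μ G 0 y - z y) y = 0
    by_cases hyΩ : y ∈ Ω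
    · rw [indicator_of_mem hyΩ, hfix 0 hh.zero_mem y (by rw [hh0]; rfl) (fun j => by rw [hh0]; simp)
        (by rw [hμ0]; rfl), sub_self]
    · exact indicator_of_notMem hyΩ _

/-- At time zero `G` moves with velocity `-v`, the dilation changes at the rate `-div v`, and `∇h`
at the rate `∇v`. For a density, `-v·∇ρ - ρ div v` combines into `-div(ρv)`. -/
theorem deriv_transport {y : Vec} (hy : y ∈ Ω) :
    deriv (fun t => Ω.indicator (fun y => transport z h μ G t y - z y) y) 0
      = transportRate z (fun y => deriv (fun t => h t y) 0) (fun y => deriv (fun t => μ t y) 0) y := by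
  set v : Vec → Vec := fun y => deriv (fun t => h t y) 0
  have hz0 : G 0 y = y := hG.eq_self hh.zero_mem (by rw [hh.2.2.2]; rfl)
  have dG := hG.hasDerivAt hh y
  have hvd : ∀ i, DifferentiableAt ℝ (fun x => v x i) y := fun i =>
    differentiableAt_pi.1 (hh.contDiff_deriv.differentiable (by simp) y) i
  have hd : ∀ {f : Vec → ℝ}, ContDiffOn ℝ ∞ f Ω → DifferentiableAt ℝ f y :=
    fun hf => (hf.contDiffAt (hΩ.mem_nhds hy)).differentiableAt (by simp)
  have df : ∀ {f : Vec → ℝ}, ContDiffOn ℝ ∞ f Ω →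
      HasDerivAt (fun t => f (G t y)) (- ∑ k, v y k * pd k f y) 0 := by
    intro f hf
    have h1 : HasFDerivAt f (fderiv ℝ f y) (G 0 y) := by rw [hz0]; exact (hd hf).hasFDerivAt
    refine (h1.comp_hasDerivAt (0 : ℝ) dG).congr_deriv ?_
    rw [map_neg, fderiv_apply_eq_sum_pd]
  have dp : ∀ j i, HasDerivAt (fun t => fderiv ℝ (h t) (G t y) (e j) i)
      (pd j (fun x => v x i) y) 0 := by
    intro j i
    have h1 := hasDerivAt_pi.1 ((hh.fderiv_apply (e j)).hasDerivAt_comp dG hz0) i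
    rw [hh.deriv_fderiv_apply] at h1
    refine h1.congr_deriv ?_
    have h2 := hasFDerivAt_pi'.1 (hh.contDiff_deriv.differentiable (by simp) y).hasFDerivAt i
    rw [pd, h2.fderiv]
    rfl
  have hp0 : ∀ j i, fderiv ℝ (h 0) (G 0 y) (e j) i = 0 := fun j i => by rw [hh.2.2.2]; simp
  have hJ0 : dilation h G 0 y = 1 := by
    have : (Matrix.of fun i j => fderiv ℝ (h 0) (G 0 y) (e j) i) = 0 := by
      ext i j; exact hp0 j i
    rw [dilation, this]; simp
  have dJ : HasDerivAt (dilation h G · y) (- ∑ j, pd j (fun x => v x j) y) 0 := by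
    have h1 := hasDerivAt_det_one_add (fun i j => dp j i) fun i j => hp0 j i
    have h3 : (1 + Matrix.of fun i j => fderiv ℝ (h 0) (G 0 y) (e j) i).det = 1 := by
      rw [← inv_inv (Matrix.det _), ← dilation, hJ0, inv_one]
    have h2 := h1.inv (by rw [h3]; exact one_ne_zero)
    refine h2.congr_deriv ?_
    rw [h3]; simp
  have dμ : ∀ i, HasDerivAt (fun t => μ t (G t y) i) (deriv (fun t => μ t y) 0 i) 0 := fun i =>
    hasDerivAt_pi.1 (hμ.hasDerivAt_comp dG hz0) i
  have hμ0 : ∀ i, μ 0 (G 0 y) i = 0 := fun i => by rw [hμ.2.2.2]; rfl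
  have hdiv : ∀ {f : Vec → ℝ}, ContDiffOn ℝ ∞ f Ω → ∑ j, pd j (fun x => f x * v x j) y
      = (∑ k, v y k * pd k f y) + f y * ∑ j, pd j (fun x => v x j) y := by
    intro f hf
    rw [Finset.mul_sum, ← Finset.sum_add_distrib]
    exact Finset.sum_congr rfl fun j _ => by rw [pd_mul (hd hf) (hvd j)]; ring
  have d1 : HasDerivAt (fun t => rho z (G t y) * dilation h G t y)
      (- ∑ j, pd j (fun x => rho z x * v x j) y) 0 := by
    refine ((df (contDiffOn_rho hz)).mul dJ).congr_deriv ?_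
    rw [hdiv (contDiffOn_rho hz), hJ0, hz0]; ring
  have d2 : ∀ i, HasDerivAt (fun t => dilation h G t y * (mo z i (G t y) + μ t (G t y) i))
      (- (∑ j, pd j (fun x => mo z i x * v x j) y) + deriv (fun t => μ t y) 0 i) 0 := by
    intro i
    refine (dJ.mul ((df (contDiffOn_mo hz i)).add (dμ i))).congr_deriv ?_
    rw [hdiv (contDiffOn_mo hz i), Pi.add_apply, hJ0, hμ0, hz0]; ring
  have d3 : HasDerivAt (fun t => ent z (G t y) * dilation h G t y)
      (- ∑ j, pd j (fun x => ent z x * v x j) y) 0 := by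
    refine ((df (contDiffOn_ent hz)).mul dJ).congr_deriv ?_
    rw [hdiv (contDiffOn_ent hz), hJ0, hz0]; ring
  have d4 : ∀ i I, HasDerivAt (fun t => ten z i I (G t y)
        + ∑ j, ten z j I (G t y) * fderiv ℝ (h t) (G t y) (e j) i)
      ((∑ j, ten z j I y * pd j (fun x => v x i) y) - ∑ k, v y k * pd k (ten z i I) y) 0 := by
    intro i I
    refine ((df (contDiffOn_ten hz i I)).add (HasDerivAt.fun_sum (u := Finset.univ) fun j _ =>
      (df (contDiffOn_ten hz j I)).mul (dp j i))).congr_deriv ?_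
    -- `hp0` refers to the point `G 0 y`, so it has to be used before `hz0` rewrites that point.
    simp only [hp0]
    simp only [hz0]
    simp
    ring
  have dt : HasDerivAt (fun t => transport z h μ G t y)
      (transportRate z v (fun y => deriv (fun t => μ t y) 0) y) 0 :=
    d1.prodMk ((hasDerivAt_pi.2 d2).prodMk
      (d3.prodMk (hasDerivAt_pi.2 fun i => hasDerivAt_pi.2 fun I => d4 i I)))
  simp only [indicator_of_mem hy]
  exact (dt.sub_const (z y)).deriv

end Transport

/-! ### Functional derivatives in the Lagrangian frame -/

/-- The force density conjugate to a displacement of the Eulerian fields `z`, for the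
functional `C` of `(ρ, m, s, F)`. -/
def force (Ω : Set Vec) (C : (Vec → EState) → ℝ) (z : Vec → EState) (i : Fin 3) (y : Vec) : ℝ :=
  rho z y * pd i (dRho Ω C z) y + (∑ j, mo z j y * pd i (dMo Ω C z j) y)
    + ent z y * pd i (dEnt Ω C z) y
    - (∑ j, pd j (fun x => ∑ I, ten z j I x * dTen Ω C z i I x) y)
    - ∑ j, ∑ I, dTen Ω C z j I y * pd i (ten z j I) y

/-- Leibniz' rule moves the derivatives off `v`; the coefficients of `v` that remain define `force`.
The flux is linear in `v` and thus inherits its support. -/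
theorem transport_identity {r s cr cs : Vec → ℝ} {m c : Fin 3 → Vec → ℝ} {v : Vec → Vec} {w : Vec}
    {F cF : Fin 3 → Fin 3 → Vec → ℝ} {y : Vec}
    (hr : DifferentiableAt ℝ r y) (hs : DifferentiableAt ℝ s y)
    (hcr : DifferentiableAt ℝ cr y) (hcs : DifferentiableAt ℝ cs y)
    (hm : ∀ i, DifferentiableAt ℝ (m i) y) (hc : ∀ i, DifferentiableAt ℝ (c i) y)
    (hv : ∀ i, DifferentiableAt ℝ (fun x => v x i) y) (hF : ∀ a b, DifferentiableAt ℝ (F a b) y)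
    (hcF : ∀ a b, DifferentiableAt ℝ (cF a b) y) :
    cr y * (- ∑ j, pd j (fun x => r x * v x j) y)
      + (∑ i, c i y * (- (∑ j, pd j (fun x => m i x * v x j) y) + w i))
      + cs y * (- ∑ j, pd j (fun x => s x * v x j) y)
      + (∑ i, ∑ I, cF i I y * ((∑ j, F j I y * pd j (fun x => v x i) y)
        - ∑ k, v y k * pd k (F i I) y))
    = (∑ i, (r y * pd i cr y + (∑ j, m j y * pd i (c j) y) + s y * pd i cs y
        - (∑ j, pd j (fun x => ∑ I, F j I x * cF i I x) y)
        - ∑ j, ∑ I, cF j I y * pd i (F j I) y) * v y i) + (∑ i, c i y * w i)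
      + ∑ j, pd j (fun x => - (cr x * (r x * v x j)) + - (∑ i, c i x * (m i x * v x j))
        + - (cs x * (s x * v x j)) + ∑ i, (∑ I, F j I x * cF i I x) * v x i) y := by
  simp (disch := fun_prop) only [pd_mul, pd_sum, pd_add, pd_neg]
  simp only [Fin.sum_univ_three]
  ring

/-- The fluid and convective terms match after renaming indices. Only the stress term `-∂_j(F^j_I
C_{F^i_I}) D_{m_i}` and its mirror image are integrated by parts. -/
theorem force_identity {r s cr cs dr ds : Vec → ℝ} {m c d : Fin 3 → Vec → ℝ}
    {F cF dF : Fin 3 → Fin 3 → Vec → ℝ} {y : Vec}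
    (hc : ∀ i, DifferentiableAt ℝ (c i) y) (hd : ∀ i, DifferentiableAt ℝ (d i) y)
    (hF : ∀ a b, DifferentiableAt ℝ (F a b) y) (hcF : ∀ a b, DifferentiableAt ℝ (cF a b) y)
    (hdF : ∀ a b, DifferentiableAt ℝ (dF a b) y) :
    ∑ i, ((r y * pd i cr y + (∑ j, m j y * pd i (c j) y) + s y * pd i cs y
        - (∑ j, pd j (fun x => ∑ I, F j I x * cF i I x) y)
        - ∑ j, ∑ I, cF j I y * pd i (F j I) y) * d i y
      - (r y * pd i dr y + (∑ j, m j y * pd i (d j) y) + s y * pd i ds y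
        - (∑ j, pd j (fun x => ∑ I, F j I x * dF i I x) y)
        - ∑ j, ∑ I, dF j I y * pd i (F j I) y) * c i y)
    = ((∑ i, r y * (pd i cr y * d i y - pd i dr y * c i y))
      + (∑ i, ∑ j, m i y * (pd j (c i) y * d j y - pd j (d i) y * c j y))
      + (∑ i, s y * (pd i cs y * d i y - pd i ds y * c i y))
      + (∑ i, ∑ j, ∑ I, F j I y * (cF i I y * pd j (d i) y - dF i I y * pd j (c i) y))
      - ∑ i, ∑ I, ∑ k, pd k (F i I) y * (cF i I y * d k y - dF i I y * c k y))
      + ∑ j, pd j (fun x => ∑ i, ((∑ I, F j I x * dF i I x) * c i x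
        + - ((∑ I, F j I x * cF i I x) * d i x))) y := by
  simp (disch := fun_prop) only [pd_mul, pd_sum, pd_add, pd_neg]
  simp only [Fin.sum_univ_three]
  ring

section Force

variable {Ω K : Set Vec} {C D : (Vec → EState) → ℝ} {z : Vec → EState} (hΩ : IsOpen Ω)
  (hK : IsCompact K) (hKΩ : K ⊆ Ω) (hz : ContDiffOn ℝ ∞ z Ω)
  (hC : SmoothlyDifferentiableAt Ω C z) (hD : SmoothlyDifferentiableAt Ω D z)

include hΩ hz hC

theorem contDiffOn_force (i : Fin 3) : ContDiffOn ℝ ∞ (force Ω C z i) Ω := by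
  have c4 := contDiffOn_ten hz
  have d4 := contDiffOn_dTen hC
  refine ContDiffOn.sub (ContDiffOn.sub (ContDiffOn.add (ContDiffOn.add ?_ ?_) ?_) ?_) ?_
  · exact (contDiffOn_rho hz).mul (contDiffOn_pd hΩ (contDiffOn_dRho hC) i)
  · exact ContDiffOn.sum fun j _ => (contDiffOn_mo hz j).mul (contDiffOn_pd hΩ (contDiffOn_dMo hC j) i)
  · exact (contDiffOn_ent hz).mul (contDiffOn_pd hΩ (contDiffOn_dEnt hC) i)
  · exact ContDiffOn.sum fun j _ => contDiffOn_pd hΩ (ContDiffOn.sum fun I _ =>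
      (c4 j I).mul (d4 i I)) j
  · exact ContDiffOn.sum fun j _ => ContDiffOn.sum fun I _ =>
      (d4 j I).mul (contDiffOn_pd hΩ (c4 j I) i)

include hK hKΩ

/-- The boundary term is removed by the support of `v`, so `C` is differentiable in the Lagrangian
fields without any support condition of its own. -/
theorem integral_funcDeriv_transportRate {v w : Vec → Vec} (hv : ContDiff ℝ ∞ v)
    (hw : ContDiff ℝ ∞ w) (hv0 : ∀ y, y ∉ K → v y = 0) (hw0 : ∀ y, y ∉ K → w y = 0) :
    ∫ y in Ω, funcDeriv Ω C z y (transportRate z v w y)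
      = ∫ y in Ω, ((∑ i, force Ω C z i y * v y i) + ∑ i, dMo Ω C z i y * w y i) := by
  have hd : ∀ {f : Vec → ℝ}, ContDiffOn ℝ ∞ f Ω → ∀ y ∈ Ω, DifferentiableAt ℝ f y :=
    fun hf y hy => (hf.contDiffAt (hΩ.mem_nhds hy)).differentiableAt (by simp)
  have c1 := contDiffOn_rho hz
  have c2 := contDiffOn_mo hz
  have c3 := contDiffOn_ent hz
  have c4 := contDiffOn_ten hz
  have d1 := contDiffOn_dRho hC
  have d2 := contDiffOn_dMo hC
  have d3 := contDiffOn_dEnt hC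
  have d4 := contDiffOn_dTen hC
  have cv : ∀ i, ContDiffOn ℝ ∞ (fun x => v x i) Ω := contDiffOn_pi.1 hv.contDiffOn
  have cw : ∀ i, ContDiffOn ℝ ∞ (fun x => w x i) Ω := contDiffOn_pi.1 hw.contDiffOn
  refine setIntegral_eq_of_sub_eq_div (Q := fun j x => - (dRho Ω C z x * (rho z x * v x j))
    + - (∑ i, dMo Ω C z i x * (mo z i x * v x j)) + - (dEnt Ω C z x * (ent z x * v x j))
    + ∑ i, (∑ I, ten z j I x * dTen Ω C z i I x) * v x i) hΩ hK hKΩ ?_ (fun j => ?_)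
    (fun j y hy hyK => ?_) fun y hy => ?_
  · exact integrableOn_of_zero_off_compact hΩ hK hKΩ ((ContDiffOn.sum fun i _ =>
      (contDiffOn_force hΩ hz hC i).mul (cv i)).add (ContDiffOn.sum fun i _ =>
      (d2 i).mul (cw i))).continuousOn fun y hy hyK => by simp [hv0 y hyK, hw0 y hyK]
  · exact ((((d1.mul (c1.mul (cv j))).neg).add (ContDiffOn.sum fun i _ =>
      (d2 i).mul ((c2 i).mul (cv j))).neg).add (d3.mul (c3.mul (cv j))).neg).add
      (ContDiffOn.sum fun i _ => (ContDiffOn.sum fun I _ => (c4 j I).mul (d4 i I)).mul (cv i))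
  · simp [hv0 y hyK]
  · rw [funcDeriv_apply]
    exact transport_identity (hd c1 y hy) (hd c3 y hy) (hd d1 y hy) (hd d3 y hy)
      (fun i => hd (c2 i) y hy) (fun i => hd (d2 i) y hy) (fun i => hd (cv i) y hy)
      (fun a b => hd (c4 a b) y hy) (fun a b => hd (d4 a b) y hy)

include hD

/-- There is no compactly supported velocity here: the flux pairs derivatives of `C` with those of
`D`, and one of the two functionals has to supply the support. -/
theorem integral_force_eq_bracketF
    (h0 : ∀ y ∈ Ω, y ∉ K → ComponentsVanish Ω C z y ∨ ComponentsVanish Ω D z y) :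
    ∫ y in Ω, ∑ i, (force Ω C z i y * dMo Ω D z i y - force Ω D z i y * dMo Ω C z i y)
      = bracketF Ω C D z := by
  have hd : ∀ {f : Vec → ℝ}, ContDiffOn ℝ ∞ f Ω → ∀ y ∈ Ω, DifferentiableAt ℝ f y :=
    fun hf y hy => (hf.contDiffAt (hΩ.mem_nhds hy)).differentiableAt (by simp)
  have c4 := contDiffOn_ten hz
  have d2 := contDiffOn_dMo hC
  have d4 := contDiffOn_dTen hC
  have e2 := contDiffOn_dMo hD
  have e4 := contDiffOn_dTen hD
  rw [bracketF_eq_integral hΩ hK hKΩ hz hC hD h0]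
  refine setIntegral_eq_of_sub_eq_div (Q := fun j x => ∑ i,
    ((∑ I, ten z j I x * dTen Ω D z i I x) * dMo Ω C z i x
      + - ((∑ I, ten z j I x * dTen Ω C z i I x) * dMo Ω D z i x))) hΩ hK hKΩ
    (integrableOn_densityF hΩ hK hKΩ hz hC hD h0) (fun j => ?_) (fun j y hy hyK => ?_)
    fun y hy => ?_
  · exact ContDiffOn.sum fun i _ => ((ContDiffOn.sum fun I _ => (c4 j I).mul (e4 i I)).mul (d2 i)).add
      ((ContDiffOn.sum fun I _ => (c4 j I).mul (d4 i I)).mul (e2 i)).neg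
  · rcases h0 y hy hyK with ⟨⟨h1, h2, h3, h4⟩, -⟩ | ⟨⟨h1, h2, h3, h4⟩, -⟩ <;> simp [h2, h4]
  · exact force_identity (fun i => hd (d2 i) y hy) (fun i => hd (e2 i) y hy)
      (fun a b => hd (c4 a b) y hy) (fun a b => hd (d4 a b) y hy) (fun a b => hd (e4 a b) y hy)

end Force

/-! ### Variations of a configuration -/

theorem IsVariation.smul_field {W : Type} [NormedAddCommGroup W] [NormedSpace ℝ W] {Ω : Set Vec}
    (hΩ : IsOpen Ω) {ε : ℝ} {η : ℝ → Vec → W} (h : IsVariation Ω ε η) {f : Vec → ℝ}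
    (hf : ContDiffOn ℝ ∞ f Ω) : IsVariation Ω ε fun t y => f y • η t y := by
  obtain ⟨hε, hs, ⟨K, hK, hKΩ, h0⟩, hz⟩ := h
  have hsupp : ∀ t ∈ Ioo (-ε) ε, ∀ y, y ∉ K → f y • η t y = 0 := fun t ht y hy => by
    rw [h0 t ht y hy, smul_zero]
  refine ⟨hε, contDiffOn_univ_prod_of_zero_off isOpen_Ioo hΩ hK.isClosed hKΩ ?_ hsupp,
    ⟨K, hK, hKΩ, hsupp⟩, by ext y; simp [hz]⟩
  exact (hf.comp contDiffOn_snd fun p hp => hp.2).smul (hs.mono (prod_mono le_rfl (subset_univ _)))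

section Lagrangian

variable {B Ω : Set Vec} (hB : IsOpen B) (hΩ : IsOpen Ω) {q : Vec → LState}
  (hq : IsConfiguration B Ω q)

include hB hΩ hq

/-- A Lagrangian variation, as a field on the Eulerian domain. -/
theorem IsVariation.pushforward {W : Type} [NormedAddCommGroup W] [NormedSpace ℝ W] {ε : ℝ}
    {η : ℝ → Vec → W} (h : IsVariation B ε η) :
    IsVariation Ω ε fun t => Ω.indicator fun y => η t (lab B q y) := by
  obtain ⟨hε, hs, ⟨K, hK, hKB, h0⟩, hz⟩ := h
  have hK' : IsCompact (pos q '' K) := hK.image_of_continuousOn (hq.contDiffOn_pos.continuousOn.mono hKB)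
  have hKΩ : pos q '' K ⊆ Ω := by
    rintro _ ⟨X, hX, rfl⟩
    exact hq.pos_mem (hKB hX)
  have hsupp : ∀ t ∈ Ioo (-ε) ε, ∀ y, y ∉ pos q '' K →
      Ω.indicator (fun y => η t (lab B q y)) y = 0 := by
    intro t ht y hy
    by_cases hyΩ : y ∈ Ω
    · rw [indicator_of_mem hyΩ]
      exact h0 t ht _ fun hX => hy ⟨_, hX, hq.pos_lab hyΩ⟩
    · exact indicator_of_notMem hyΩ _
  refine ⟨hε, contDiffOn_univ_prod_of_zero_off isOpen_Ioo hΩ hK'.isClosed hKΩ ?_ hsupp,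
    ⟨_, hK', hKΩ, hsupp⟩, ?_⟩
  · have c1 : ContDiffOn ℝ ∞ (fun p : ℝ × Vec => (p.1, lab B q p.2)) (Ioo (-ε) ε ×ˢ Ω) :=
      contDiffOn_fst.prodMk ((hq.contDiffOn_lab hB).comp contDiffOn_snd fun p hp => hp.2)
    exact (hs.comp c1 fun p hp => ⟨hp.1, mem_univ _⟩).congr fun p hp =>
      indicator_of_mem hp.2 fun y => η p.1 (lab B q y)
  · ext1 y
    change Ω.indicator (fun y => η 0 (lab B q y)) y = 0
    simp [hz]

omit hB hΩ in
theorem toEulerF_apply (ρ₀ s₀ : Vec → ℝ) {y : Vec} (hy : y ∈ Ω) : toEulerF B ρ₀ s₀ q y =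
    (ρ₀ (lab B q y) * (fderiv ℝ (lab B q) y).det,
     (fderiv ℝ (lab B q) y).det • mom q (lab B q y),
     s₀ (lab B q y) * (fderiv ℝ (lab B q) y).det,
     fun i I => fderiv ℝ (pos q) (lab B q y) (e I) i) := by
  rw [← hq.image] at hy
  rw [toEulerF, if_pos hy]

theorem contDiffOn_det_fderiv_lab : ContDiffOn ℝ ∞ (fun y => (fderiv ℝ (lab B q) y).det) Ω :=
  contDiff_clm_det.comp_contDiffOn ((hq.contDiffOn_lab hB).fderiv_of_isOpen hΩ (m := ∞) le_rfl)

variable {ρ₀ s₀ : Vec → ℝ}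

theorem contDiffOn_toEulerF (hρ : ContDiffOn ℝ ∞ ρ₀ B) (hs : ContDiffOn ℝ ∞ s₀ B) :
    ContDiffOn ℝ ∞ (toEulerF B ρ₀ s₀ q) Ω := by
  have cl := hq.contDiffOn_lab hB
  have cJ := contDiffOn_det_fderiv_lab hB hΩ hq
  have hm : MapsTo (lab B q) Ω B := fun y hy => hq.lab_mem hy
  have cM : ContDiffOn ℝ ∞ (fun y => mom q (lab B q y)) Ω := hq.smooth.snd.comp cl hm
  have cF : ContDiffOn ℝ ∞ (fun y => fderiv ℝ (pos q) (lab B q y)) Ω :=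
    (hq.contDiffOn_pos.fderiv_of_isOpen hB (m := ∞) le_rfl).comp cl hm
  refine (((hρ.comp cl hm).mul cJ).prodMk ((cJ.smul cM).prodMk (((hs.comp cl hm).mul cJ).prodMk
    (contDiffOn_pi.2 fun i => contDiffOn_pi.2 fun I =>
      contDiffOn_pi.1 (cF.clm_apply (contDiffOn_const (c := e I))) i)))).congr fun y hy => ?_
  exact toEulerF_apply hq ρ₀ s₀ hy

omit hΩ hB in
theorem det_toEulerF_ne_zero {y : Vec} (hy : y ∈ Ω) :
    (Matrix.of (toEulerF B ρ₀ s₀ q y).2.2.2).det ≠ 0 := by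
  rw [toEulerF_apply hq ρ₀ s₀ hy]
  have := clm_det_eq (fderiv ℝ (pos q) (lab B q y))
  simp only
  rw [← this]
  exact (hq.det_pos _ (hq.lab_mem hy)).ne'

/-- The Eulerian fields of a varied configuration are the transported Eulerian fields. -/
theorem toEulerF_add {δ : ℝ} {η : ℝ → Vec → LState}
    {h μ G : ℝ → Vec → Vec} (hh : ∀ t, ∀ y ∈ Ω, h t y = (η t (lab B q y)).1)
    (hv : IsVariation Ω δ h)
    (hμ : ∀ t, ∀ y ∈ Ω, μ t y = (fderiv ℝ (lab B q) y).det • (η t (lab B q y)).2)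
    (hG : IsInverseFlow δ h G) {t : ℝ} (ht : t ∈ Ioo (-δ) δ) :
    toEulerF B ρ₀ s₀ (q + η t) = toEulerF B ρ₀ s₀ q
      + Ω.indicator fun y => transport (toEulerF B ρ₀ s₀ q) h μ G t y - toEulerF B ρ₀ s₀ q y := by
  have hGΩ : ∀ {y}, G t y ∈ Ω ↔ y ∈ Ω := by
    obtain ⟨-, -, ⟨K, -, hKΩ, h0⟩, -⟩ := hv
    exact hG.mem_iff (fun t ht y hy => h0 t ht y fun hK => hy (hKΩ hK)) ht
  -- The varied motion is `(id + h t) ∘ x`. Hence it is again a bijection of `B` onto `Ω`, with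
  -- inverse `lab ∘ G t`.
  have hpos : ∀ X ∈ B, pos (q + η t) X = pos q X + h t (pos q X) := fun X hX => by
    rw [hh t _ (hq.pos_mem hX), hq.lab_pos hX]; rfl
  have hΦ : Function.Injective fun x => x + h t x :=
    Function.LeftInverse.injective (g := G t) (hG.left_inv t ht)
  have hinj : InjOn (pos (q + η t)) B := fun X hX X' hX' heq => by
    rw [hpos X hX, hpos X' hX'] at heq
    exact hq.injOn hX hX' (hΦ heq)
  have hpl : ∀ y ∈ Ω, pos (q + η t) (lab B q (G t y)) = y := fun y hy => by
    rw [hpos _ (hq.lab_mem (hGΩ.2 hy)), hq.pos_lab (hGΩ.2 hy), hG.right_inv t ht]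
  have himg : pos (q + η t) '' B = Ω := by
    refine Subset.antisymm ?_ fun y hy => ⟨_, hq.lab_mem (hGΩ.2 hy), hpl y hy⟩
    rintro _ ⟨X, hX, rfl⟩
    rw [← hGΩ, hpos X hX, hG.left_inv t ht]
    exact hq.pos_mem hX
  have hlab : ∀ y ∈ Ω, lab B (q + η t) y = lab B q (G t y) := fun y hy => by
    have := hinj.leftInvOn_invFunOn (hq.lab_mem (hGΩ.2 hy))
    rwa [hpl y hy] at this
  ext1 y
  by_cases hy : y ∈ Ω
  swap
  · rw [Pi.add_apply, indicator_of_notMem hy, toEulerF, toEulerF, himg, hq.image, if_neg hy,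
      if_neg hy, add_zero]
  rw [Pi.add_apply, indicator_of_mem hy, add_sub_cancel]
  set x := G t y with hx
  have hxΩ : x ∈ Ω := hGΩ.2 hy
  have hdl : fderiv ℝ (lab B (q + η t)) y = (fderiv ℝ (lab B q) x).comp (fderiv ℝ (G t) y) := by
    have h1 : HasFDerivAt (fun y => lab B q (G t y)) _ y :=
      (hq.hasFDerivAt_lab hB hΩ hxΩ).comp y (hG.hasFDerivAt ht y)
    refine (h1.congr_of_eventuallyEq ?_).fderiv
    exact Filter.eventuallyEq_of_mem (hΩ.mem_nhds hy) hlab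
  have hJ : (fderiv ℝ (lab B (q + η t)) y).det = (fderiv ℝ (lab B q) x).det * dilation h G t y := by
    rw [hdl, dilation, inv_eq_of_mul_eq_one_right (hG.det_mul_det hv ht y)]
    exact LinearMap.det_comp _ _
  have hdp : fderiv ℝ (pos (q + η t)) (lab B q x)
      = (ContinuousLinearMap.id ℝ Vec + fderiv ℝ (h t) x).comp (fderiv ℝ (pos q) (lab B q x)) := by
    have h1 := hq.hasFDerivAt_pos hB (hq.lab_mem hxΩ)
    have h2 : HasFDerivAt (fun x => x + h t x) (ContinuousLinearMap.id ℝ Vec + fderiv ℝ (h t) x)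
        (pos q (lab B q x)) := by
      rw [hq.pos_lab hxΩ]
      exact (hasFDerivAt_id _).add (hv.hasFDerivAt ht _).differentiableAt.hasFDerivAt
    refine ((h2.comp _ h1).congr_of_eventuallyEq ?_).fderiv
    exact Filter.eventuallyEq_of_mem (hB.mem_nhds (hq.lab_mem hxΩ)) hpos
  have hz := toEulerF_apply hq ρ₀ s₀ hxΩ
  have e0 : toEulerF B ρ₀ s₀ (q + η t) y =
      (ρ₀ (lab B (q + η t) y) * (fderiv ℝ (lab B (q + η t)) y).det,
       (fderiv ℝ (lab B (q + η t)) y).det • mom (q + η t) (lab B (q + η t) y),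
       s₀ (lab B (q + η t) y) * (fderiv ℝ (lab B (q + η t)) y).det,
       fun i I => fderiv ℝ (pos (q + η t)) (lab B (q + η t) y) (e I) i) := by
    rw [toEulerF, if_pos (himg.symm ▸ hy)]
  rw [e0, hlab y hy, ← hx, hJ, hdp]
  simp only [transport, rho, mo, ent, ten, ← hx, hz]
  refine Prod.ext (by simp only; ring) (Prod.ext ?_ (Prod.ext (by simp only; ring) ?_))
  · ext i
    simp only [hμ t x hxΩ, mom, Pi.add_apply, Pi.smul_apply, smul_eq_mul, Prod.snd_add]
    ring
  · ext i I
    simp only [ContinuousLinearMap.comp_apply, add_apply,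
      ContinuousLinearMap.id_apply, Pi.add_apply]
    rw [clm_apply_eq_sum (fderiv ℝ (h t) x)]
    simp

/-- The functional derivative with respect to `(x, M)` of a functional of `(ρ, m, s, F)`. -/
def lagrangianDeriv (Ω : Set Vec) (C : (Vec → EState) → ℝ) (q : Vec → LState) (z : Vec → EState)
    (X : Vec) : LState →L[ℝ] ℝ :=
  (∑ i, ((fderiv ℝ (pos q) X).det * force Ω C z i (pos q X)) •
    (ContinuousLinearMap.proj (R := ℝ) (φ := fun _ : Fin 3 => ℝ) i).comp
      (ContinuousLinearMap.fst ℝ Vec Vec))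
  + ∑ i, dMo Ω C z i (pos q X) •
    (ContinuousLinearMap.proj (R := ℝ) (φ := fun _ : Fin 3 => ℝ) i).comp
      (ContinuousLinearMap.snd ℝ Vec Vec)

omit hB hΩ hq in
theorem lagrangianDeriv_apply (C : (Vec → EState) → ℝ) (z : Vec → EState) (X : Vec) (u : LState) :
    lagrangianDeriv Ω C q z X u
      = (∑ i, (fderiv ℝ (pos q) X).det * force Ω C z i (pos q X) * u.1 i)
        + ∑ i, dMo Ω C z i (pos q X) * u.2 i := by
  simp [lagrangianDeriv]

theorem contDiffOn_lagrangianDeriv {C : (Vec → EState) → ℝ} {z : Vec → EState}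
    (hz : ContDiffOn ℝ ∞ z Ω) (hC : SmoothlyDifferentiableAt Ω C z) :
    ContDiffOn ℝ ∞ (lagrangianDeriv Ω C q z) B := by
  have cx := hq.contDiffOn_pos
  have hm : MapsTo (pos q) B Ω := fun X hX => hq.pos_mem hX
  have cd : ContDiffOn ℝ ∞ (fun X => (fderiv ℝ (pos q) X).det) B :=
    contDiff_clm_det.comp_contDiffOn (cx.fderiv_of_isOpen hB (m := ∞) le_rfl)
  exact (ContDiffOn.sum fun i _ => (cd.mul ((contDiffOn_force hΩ hz hC i).comp cx hm)).smul
    contDiffOn_const).add (ContDiffOn.sum fun i _ =>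
      ((contDiffOn_dMo hC i).comp cx hm).smul contDiffOn_const)

/-- The chain rule through the Lagrange-to-Euler map: push the variation forward, differentiate `C`
along the transported fields, integrate by parts on `Ω`, and change variables back to `B`. -/
theorem hasFunctionalDeriv_comp_toEulerF (hρ : ContDiffOn ℝ ∞ ρ₀ B) (hs : ContDiffOn ℝ ∞ s₀ B)
    {C : (Vec → EState) → ℝ} (hC : SmoothlyDifferentiableAt Ω C (toEulerF B ρ₀ s₀ q)) :
    HasFunctionalDeriv B (C ∘ toEulerF B ρ₀ s₀) q
      (lagrangianDeriv Ω C q (toEulerF B ρ₀ s₀ q)) := by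
  intro ε η hη
  set z := toEulerF B ρ₀ s₀ q
  have hz : ContDiffOn ℝ ∞ z Ω := contDiffOn_toEulerF hB hΩ hq hρ hs
  have hκ := hη.pushforward hB hΩ hq
  have hh := hκ.clm_comp (ContinuousLinearMap.fst ℝ Vec Vec)
  have hμ := (hκ.clm_comp (ContinuousLinearMap.snd ℝ Vec Vec)).smul_field hΩ
    (contDiffOn_det_fderiv_lab hB hΩ hq)
  set h : ℝ → Vec → Vec := fun t y => ContinuousLinearMap.fst ℝ Vec Vec
    (Ω.indicator (fun y => η t (lab B q y)) y) with hhdef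
  set μ : ℝ → Vec → Vec := fun t y => (fderiv ℝ (lab B q) y).det •
    ContinuousLinearMap.snd ℝ Vec Vec (Ω.indicator (fun y => η t (lab B q y)) y) with hμdef
  have hhΩ : ∀ t, ∀ y ∈ Ω, h t y = (η t (lab B q y)).1 := fun t y hy => by
    simp [hhdef, indicator_of_mem hy]
  have hμΩ : ∀ t, ∀ y ∈ Ω, μ t y = (fderiv ℝ (lab B q) y).det • (η t (lab B q y)).2 :=
    fun t y hy => by simp [hμdef, indicator_of_mem hy]
  obtain ⟨δ, hδ, hδε, G, hG⟩ := hh.exists_isInverseFlow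
  have hh' := hh.mono hδ hδε
  have hμ' := hμ.mono hδ hδε
  have hζ := isVariation_transport hΩ hG hh' hμ' hz
  have key := hC.hasFunctionalDeriv δ _ hζ
  have heq : (fun t => (C ∘ toEulerF B ρ₀ s₀) (q + η t)) =ᶠ[nhds 0] fun t =>
      C (z + Ω.indicator fun y => transport z h μ G t y - z y) := by
    filter_upwards [isOpen_Ioo.mem_nhds hh'.zero_mem] with t ht
    simp only [Function.comp_apply]
    rw [toEulerF_add hB hΩ hq hhΩ hh' hμΩ hG ht]
  refine (key.congr_of_eventuallyEq heq).congr_deriv ?_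
  obtain ⟨-, -, ⟨K₁, hK₁, hK₁Ω, h0⟩, -⟩ := id hh'
  obtain ⟨-, -, ⟨K₂, hK₂, hK₂Ω, μ0⟩, -⟩ := id hμ'
  have hdη : ∀ X, HasDerivAt (fun t => η t X) (deriv (fun t => η t X) 0) 0 := fun X =>
    (hη.hasDerivAt hη.zero_mem X).differentiableAt.hasDerivAt
  have hdh : ∀ X ∈ B, deriv (fun t => h t (pos q X)) 0 = (deriv (fun t => η t X) 0).1 := by
    intro X hX
    simp only [hhΩ _ _ (hq.pos_mem hX), hq.lab_pos hX]
    exact ((ContinuousLinearMap.fst ℝ Vec Vec).hasFDerivAt.comp_hasDerivAt (0 : ℝ) (hdη X)).deriv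
  have hdμ : ∀ X ∈ B, deriv (fun t => μ t (pos q X)) 0
      = (fderiv ℝ (lab B q) (pos q X)).det • (deriv (fun t => η t X) 0).2 := by
    intro X hX
    simp only [hμΩ _ _ (hq.pos_mem hX), hq.lab_pos hX]
    have h2 : HasDerivAt (fun t => (η t X).2) (deriv (fun t => η t X) 0).2 0 :=
      (ContinuousLinearMap.snd ℝ Vec Vec).hasFDerivAt.comp_hasDerivAt (0 : ℝ) (hdη X)
    exact (h2.const_smul (fderiv ℝ (lab B q) (pos q X)).det).deriv
  calc _ = ∫ y in Ω, funcDeriv Ω C z y (transportRate z (fun y => deriv (fun t => h t y) 0)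
        (fun y => deriv (fun t => μ t y) 0) y) :=
        setIntegral_congr_fun hΩ.measurableSet fun y hy =>
          congrArg _ (deriv_transport hΩ hG hh' hμ' hz hy)
    _ = _ := integral_funcDeriv_transportRate hΩ (hK₁.union hK₂) (union_subset hK₁Ω hK₂Ω) hz hC
        hh'.contDiff_deriv hμ'.contDiff_deriv
        (fun y hy => IsVariation.deriv_eq_zero hδ h0 fun hK => hy (Or.inl hK))
        (fun y hy => IsVariation.deriv_eq_zero hδ μ0 fun hK => hy (Or.inr hK))
    _ = _ := hq.setIntegral_eq hB _
    _ = _ := by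
        refine setIntegral_congr_fun hB.measurableSet fun X hX => ?_
        have hdet := hq.det_mul_det hB hΩ (hq.pos_mem hX)
        rw [hq.lab_pos hX] at hdet
        simp only [lagrangianDeriv_apply, hdh X hX, hdμ X hX, Pi.smul_apply, smul_eq_mul, mul_add,
          Finset.mul_sum]
        congr 1
        · exact Finset.sum_congr rfl fun i _ => by ring
        · refine Finset.sum_congr rfl fun i _ => ?_
          -- The factor `J` in `δm = J δM` cancels the Jacobian of the change of variables, so
          -- `δC/δM` carries no determinant.
          linear_combination (dMo Ω C z i (pos q X) * (deriv (fun t => η t X) 0).2 i) * hdet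

theorem smoothlyDifferentiableAt_comp_toEulerF (hρ : ContDiffOn ℝ ∞ ρ₀ B)
    (hs : ContDiffOn ℝ ∞ s₀ B) {C : (Vec → EState) → ℝ}
    (hC : SmoothlyDifferentiableAt Ω C (toEulerF B ρ₀ s₀ q)) :
    SmoothlyDifferentiableAt B (C ∘ toEulerF B ρ₀ s₀) q :=
  ⟨_, contDiffOn_lagrangianDeriv hB hΩ hq (contDiffOn_toEulerF hB hΩ hq hρ hs) hC,
    hasFunctionalDeriv_comp_toEulerF hB hΩ hq hρ hs hC⟩

theorem funcDeriv_comp_toEulerF (hρ : ContDiffOn ℝ ∞ ρ₀ B) (hs : ContDiffOn ℝ ∞ s₀ B)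
    {C : (Vec → EState) → ℝ} (hC : SmoothlyDifferentiableAt Ω C (toEulerF B ρ₀ s₀ q)) {X : Vec}
    (hX : X ∈ B) (i : Fin 3) :
    dX B (C ∘ toEulerF B ρ₀ s₀) q i X
        = (fderiv ℝ (pos q) X).det * force Ω C (toEulerF B ρ₀ s₀ q) i (pos q X) ∧
      dMom B (C ∘ toEulerF B ρ₀ s₀) q i X = dMo Ω C (toEulerF B ρ₀ s₀ q) i (pos q X) := by
  have h := funcDeriv_eqOn hB
    (contDiffOn_lagrangianDeriv hB hΩ hq (contDiffOn_toEulerF hB hΩ hq hρ hs) hC)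
    (hasFunctionalDeriv_comp_toEulerF hB hΩ hq hρ hs hC) hX
  constructor
  · rw [dX, h, lagrangianDeriv_apply]
    simp [e, Pi.single_apply]
  · rw [dMom, h, lagrangianDeriv_apply]
    simp [e, Pi.single_apply]

/-- The determinant in `δC/δx` is exactly the Jacobian that carries the integral over `B` to `Ω`. -/
theorem bracketL_comp_toEulerF (hρ : ContDiffOn ℝ ∞ ρ₀ B) (hs : ContDiffOn ℝ ∞ s₀ B)
    {C D : (Vec → EState) → ℝ} (hC : SmoothlyDifferentiableAt Ω C (toEulerF B ρ₀ s₀ q))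
    (hD : SmoothlyDifferentiableAt Ω D (toEulerF B ρ₀ s₀ q))
    (hsupp : CompactlySupportedDeriv Ω C (toEulerF B ρ₀ s₀ q) ∨
      CompactlySupportedDeriv Ω D (toEulerF B ρ₀ s₀ q)) :
    bracketL B (C ∘ toEulerF B ρ₀ s₀) (D ∘ toEulerF B ρ₀ s₀) q
      = bracketF Ω C D (toEulerF B ρ₀ s₀ q) := by
  obtain ⟨K, hK, hKΩ, h0⟩ := exists_componentsVanish hΩ hsupp
  rw [← integral_force_eq_bracketF hΩ hK hKΩ (contDiffOn_toEulerF hB hΩ hq hρ hs) hC hD h0,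
    hq.setIntegral_eq hB]
  refine setIntegral_congr_fun hB.measurableSet fun X hX => ?_
  simp only [funcDeriv_comp_toEulerF hB hΩ hq hρ hs hC hX,
    funcDeriv_comp_toEulerF hB hΩ hq hρ hs hD hX, Finset.mul_sum]
  exact Finset.sum_congr rfl fun i _ => by ring

end Lagrangian

theorem compactlySupportedDeriv_comp_toDistortion {Ω : Set Vec} (hΩ : IsOpen Ω) {z : Vec → EState}
    (hz : ContDiffOn ℝ ∞ z Ω) (hdet : ∀ y ∈ Ω, (Matrix.of (z y).2.2.2).det ≠ 0)
    {C : (Vec → EState) → ℝ} (hC : SmoothlyDifferentiableAt Ω C (toDistortion z))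
    (hsupp : CompactlySupportedDeriv Ω C (toDistortion z)) :
    CompactlySupportedDeriv Ω (C ∘ toDistortion) z := by
  obtain ⟨K, hK, hKΩ, h0⟩ := hsupp
  refine ⟨K, hK, hKΩ, fun y hy hyK => ContinuousLinearMap.ext fun u => ?_⟩
  rw [funcDeriv_comp_toDistortion hΩ hz hdet hC hy, h0 y hy hyK]
  rfl

end ContinuumMechanics

end

/-! ### Assembly of the four assertions -/

theorem mainTheorem2 (Ω : Set Vec) (hΩ : IsOpen Ω) :
    -- reduction of the canonical bracket to the bracket for the deformation gradient
    (∀ (B : Set Vec) (ρ₀ s₀ : Vec → ℝ) (q : Vec → LState), IsOpen B →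
      ContDiffOn ℝ ∞ ρ₀ B → ContDiffOn ℝ ∞ s₀ B → IsConfiguration B Ω q →
      ∀ C D : (Vec → EState) → ℝ,
        SmoothlyDifferentiableAt Ω C (toEulerF B ρ₀ s₀ q) →
        SmoothlyDifferentiableAt Ω D (toEulerF B ρ₀ s₀ q) →
        (CompactlySupportedDeriv Ω C (toEulerF B ρ₀ s₀ q) ∨
          CompactlySupportedDeriv Ω D (toEulerF B ρ₀ s₀ q)) →
        SmoothlyDifferentiableAt B (C ∘ toEulerF B ρ₀ s₀) q ∧
        SmoothlyDifferentiableAt B (D ∘ toEulerF B ρ₀ s₀) q ∧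
        bracketL B (C ∘ toEulerF B ρ₀ s₀) (D ∘ toEulerF B ρ₀ s₀) q
          = bracketF Ω C D (toEulerF B ρ₀ s₀ q)) ∧
    -- change of variables from the deformation gradient to the distortion
    (∀ z : Vec → EState, ContDiffOn ℝ ∞ z Ω →
      (∀ y ∈ Ω, (Matrix.of (z y).2.2.2).det ≠ 0) →
      ∀ C D : (Vec → EState) → ℝ,
        SmoothlyDifferentiableAt Ω C (toDistortion z) →
        SmoothlyDifferentiableAt Ω D (toDistortion z) →
        SmoothlyDifferentiableAt Ω (C ∘ toDistortion) z ∧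
        SmoothlyDifferentiableAt Ω (D ∘ toDistortion) z ∧
        bracketF Ω (C ∘ toDistortion) (D ∘ toDistortion) z
          = bracketA Ω C D (toDistortion z)) ∧
    -- reduction of the canonical bracket to the bracket for the distortion
    (∀ (B : Set Vec) (ρ₀ s₀ : Vec → ℝ) (q : Vec → LState), IsOpen B →
      ContDiffOn ℝ ∞ ρ₀ B → ContDiffOn ℝ ∞ s₀ B → IsConfiguration B Ω q →
      ∀ C D : (Vec → EState) → ℝ,
        SmoothlyDifferentiableAt Ω C (toEulerA B ρ₀ s₀ q) →
        SmoothlyDifferentiableAt Ω D (toEulerA B ρ₀ s₀ q) →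
        (CompactlySupportedDeriv Ω C (toEulerA B ρ₀ s₀ q) ∨
          CompactlySupportedDeriv Ω D (toEulerA B ρ₀ s₀ q)) →
        SmoothlyDifferentiableAt B (C ∘ toEulerA B ρ₀ s₀) q ∧
        SmoothlyDifferentiableAt B (D ∘ toEulerA B ρ₀ s₀) q ∧
        bracketL B (C ∘ toEulerA B ρ₀ s₀) (D ∘ toEulerA B ρ₀ s₀) q
          = bracketA Ω C D (toEulerA B ρ₀ s₀ q)) ∧
    -- the bracket for the distortion gives the evolution of functionals of `(ρ, m, s, A)` ...
    (∀ z : Vec → EState, ContDiffOn ℝ ∞ z Ω → ∀ C E : (Vec → EState) → ℝ,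
      SmoothlyDifferentiableAt Ω C z → SmoothlyDifferentiableAt Ω E z →
      (CompactlySupportedDeriv Ω C z ∨ CompactlySupportedDeriv Ω E z) →
      bracketA Ω C E z = ∫ y in Ω, funcDeriv Ω C z y (evolutionA Ω E z y)) ∧
    -- ... and the evolution equations of the fields `(ρ, m, s, A)` themselves
    (∀ (a b : ℝ) (z : ℝ → Vec → EState),
      ContDiffOn ℝ ∞ (Function.uncurry z) (Ioo a b ×ˢ Ω) →
      ∀ t ∈ Ioo a b, ∀ E : (Vec → EState) → ℝ, SmoothlyDifferentiableAt Ω E (z t) →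
      ((∀ φ : Vec → EState →L[ℝ] ℝ, IsTest Ω φ →
          HasDerivAt (fun τ => smeared Ω φ (z τ)) (bracketA Ω (smeared Ω φ) E (z t)) t) ↔
        ∀ y ∈ Ω, HasDerivAt (fun τ => z τ y) (evolutionA Ω E (z t) y) t)) := by
  have hL : ∀ (B : Set Vec) (ρ₀ s₀ : Vec → ℝ) (q : Vec → LState), IsOpen B →
      ContDiffOn ℝ ∞ ρ₀ B → ContDiffOn ℝ ∞ s₀ B → IsConfiguration B Ω q →
      ∀ C D : (Vec → EState) → ℝ,
        SmoothlyDifferentiableAt Ω C (toEulerF B ρ₀ s₀ q) →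
        SmoothlyDifferentiableAt Ω D (toEulerF B ρ₀ s₀ q) →
        (CompactlySupportedDeriv Ω C (toEulerF B ρ₀ s₀ q) ∨
          CompactlySupportedDeriv Ω D (toEulerF B ρ₀ s₀ q)) →
        SmoothlyDifferentiableAt B (C ∘ toEulerF B ρ₀ s₀) q ∧
        SmoothlyDifferentiableAt B (D ∘ toEulerF B ρ₀ s₀) q ∧
        bracketL B (C ∘ toEulerF B ρ₀ s₀) (D ∘ toEulerF B ρ₀ s₀) q
          = bracketF Ω C D (toEulerF B ρ₀ s₀ q) :=
    fun B ρ₀ s₀ q hB hρ hs hq C D hC hD hsupp =>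
      ⟨smoothlyDifferentiableAt_comp_toEulerF hB hΩ hq hρ hs hC,
        smoothlyDifferentiableAt_comp_toEulerF hB hΩ hq hρ hs hD,
        bracketL_comp_toEulerF hB hΩ hq hρ hs hC hD hsupp⟩
  refine ⟨hL, fun z hz hdet C D hC hD =>
    ⟨smoothlyDifferentiableAt_comp_toDistortion hΩ hz hdet hC,
      smoothlyDifferentiableAt_comp_toDistortion hΩ hz hdet hD,
      bracketF_comp_toDistortion hΩ hz hdet hC hD⟩, ?_,
    fun z hz C E hC hE hsupp => bracketA_eq_integral_evolutionA hΩ hz hE hC hsupp,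
    fun a b z hz t ht E hE => evolution_iff hΩ hz ht hE⟩
  intro B ρ₀ s₀ q hB hρ hs hq C D hC hD hsupp
  have hz := contDiffOn_toEulerF hB hΩ hq hρ hs
  have hdet : ∀ y ∈ Ω, (Matrix.of (toEulerF B ρ₀ s₀ q y).2.2.2).det ≠ 0 :=
    fun y hy => det_toEulerF_ne_zero hq hy
  -- `toEulerA` is `toDistortion` after `toEulerF`, so the first assertion is applied to `C ∘
  -- toDistortion` and `D ∘ toDistortion`; the pointwise change of variables preserves the support
  -- of the derivative.
  have h := hL B ρ₀ s₀ q hB hρ hs hq (C ∘ toDistortion) (D ∘ toDistortion)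
    (smoothlyDifferentiableAt_comp_toDistortion hΩ hz hdet hC)
    (smoothlyDifferentiableAt_comp_toDistortion hΩ hz hdet hD)
    (hsupp.imp (compactlySupportedDeriv_comp_toDistortion hΩ hz hdet hC)
      (compactlySupportedDeriv_comp_toDistortion hΩ hz hdet hD))
  exact ⟨h.1, h.2.1, h.2.2.trans (bracketF_comp_toDistortion hΩ hz hdet hC hD)⟩
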